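/- \textbf{Setting.} Let $\mathcal{H}_S$ be a finite-dimensional complex Hilbert space, $d=\dim \mathcal{H}_S$, and $\mathcal{H}_A$ a complex separable Hilbert space, possibly infinite-dimensional. For a Hilbert space $\mathcal{H}$ write $\mathcal{L}(\mathcal{H})$ for the bounded operators and $\mathcal{T}(\mathcal{H})$ for the trace-class operators. An \emph{operation} is a completely positive, trace non-increasing linear map between spaces of trace-class operators; a \emph{channel} is a trace-preserving operation; the dual $\Phi^*$ is given by $\mathrm{tr}[\Phi^*(A)T]=\mathrm{tr}[A\Phi(T)]$. A (discrete) \emph{observable} $\mathsf{E}=\{\mathsf{E}(x):x\in\mathcal{X}\}$, with $\mathcal{X}$ countable, is a family of positive operators with $\sum_x \mathsf{E}(x)=\mathbb{1}$. An $\mathsf{E}$-\emph{instrument} $\mathcal{I}=\{\mathcal{I}_x : x\in\mathcal{X}\}$ on $\mathcal{H}_S$ is a family of operations $\mathcal{I}_x:\mathcal{T}(\mathcal{H}_S)\to\mathcal{T}(\mathcal{H}_S)$ such that $\mathcal{I}_{\mathcal{X}}:=\sum_x\mathcal{I}_x$ is a channel and $\mathcal{I}_x^*(\mathbb{1})=\mathsf{E}(x)$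 for all $x$. A \emph{measurement scheme} $(\mathcal{H}_A,\xi,\mathcal{E},\mathsf{Z})$ for $\mathcal{I}$ consists of a state $\xi$ on $\mathcal{H}_A$, a channel $\mathcal{E}:\mathcal{T}(\mathcal{H}_S\otimes\mathcal{H}_A)\to\mathcal{T}(\mathcal{H}_S\otimes\mathcal{H}_A)$ and an observable $\mathsf{Z}=\{\mathsf{Z}(x):x\in\mathcal{X}\}$ on $\mathcal{H}_A$ such that $\mathcal{I}_x(T)=\mathrm{tr}_A[(\mathbb{1}\otimes\mathsf{Z}(x))\,\mathcal{E}(T\otimes\xi)]$ for all $x$ and $T$. Let $\rho_0:=\lim_{n\to\infty}\frac1n\sum_{k=1}^n \mathcal{I}_{\mathcal{X}}^k(\mathbb{1}/d)$ (the limit exists), and let $P$ be the smallest projection with $\rho_0=P\rho_0P$; equivalently, $P$ is the smallest projection such that $\rho=P\rho P$ for every state $\rho$ with $\mathcal{I}_{\mathcal{X}}(\rho)=\rho$. Put $\mathcal{I}_P^*(A):=P\,\mathcal{I}_{\mathcal{X}}^*(A)\,P$ and $P\mathsf{E}P:=\{P\mathsf{E}(x)P : x\in\mathcal{X}\}$.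 \textbf{Theorem.} Let $(\mathcal{H}_A,\xi,\mathcal{E},\mathsf{Z})$ be a measurement scheme for an $\mathsf{E}$-instrument $\mathcal{I}$ on $\mathcal{H}_S$. Let $N_S\in\mathcal{L}(\mathcal{H}_S)$ and $N_A\in\mathcal{L}(\mathcal{H}_A)$ be self-adjoint, and assume that $\mathcal{E}$ conserves $N=N_S\otimes\mathbb{1}+\mathbb{1}\otimes N_A$ on average, that is, $\mathrm{tr}[N\mathcal{E}(\rho)]=\mathrm{tr}[N\rho]$ for all states $\rho$ on $\mathcal{H}_S\otimes\mathcal{H}_A$. Then, without assuming that $\mathcal{I}_{\mathcal{X}}$ has a faithful fixed state: \begin{enumerate} \item[(i)] If $\mathcal{I}$ does not disturb a discrete observable $\mathsf{F}=\{\mathsf{F}(y):y\in\mathcal{Y}\}$ on $\mathcal{H}_S$, i.e. $\mathcal{I}_{\mathcal{X}}^*(\mathsf{F}(y))=\mathsf{F}(y)$ for all $y$, then every $P\mathsf{F}(y)P$ commutes with every $P\mathsf{E}(x)P$ and with $\Delta PN_SP:=\mathcal{I}_P^*(PN_SP)-PN_SP$; for such an $\mathsf{F}$, $[P\mathsf{F}P,PN_SP]=0$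 is sufficient for $[P\mathsf{F}P,\Delta PN_SP]=0$. \item[(ii)] If $\mathcal{I}$ is a measurement of the first kind, i.e. $\mathcal{I}_{\mathcal{X}}^*(\mathsf{E}(x))=\mathsf{E}(x)$ for all $x$, then the operators $P\mathsf{E}(x)P$ commute with one another and with $PN_SP$. \item[(iii)] If $\mathcal{I}$ is repeatable, i.e. $\mathrm{tr}[\mathcal{I}_y(\mathcal{I}_x(\rho))]=\delta_{x,y}\mathrm{tr}[\mathcal{I}_x(\rho)]$ for all states $\rho$ and all $x,y$, then $P\mathsf{E}P$ is sharp, i.e. $P\mathsf{E}(x)P\cdot P\mathsf{E}(y)P=\delta_{x,y}P\mathsf{E}(x)P$ for all $x,y$, and every $P\mathsf{E}(x)P$ commutes with $PN_SP$. \end{enumerate} -/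

import Mathlib

open scoped TensorProduct ComplexOrder InnerProductSpace

namespace WAY

noncomputable section

/-! ### Trace-class operators and the trace -/

/-- `T` is trace class: `T = ∑ₙ |uₙ⟩⟨vₙ|` with `∑ₙ ‖uₙ‖ ‖vₙ‖ < ∞` (on a Hilbert space this is
equivalent to `tr |T| < ∞`). -/
def IsTraceClass {H : Type*} [NormedAddCommGroup H] [InnerProductSpace ℂ H]
    (T : H →L[ℂ] H) : Prop :=
  ∃ u v : ℕ → H, Summable (fun n => ‖u n‖ * ‖v n‖) ∧
    ∀ x, HasSum (fun n => ⟪v n, x⟫_ℂ • u n) (T x)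

theorem IsTraceClass.zero {H : Type*} [NormedAddCommGroup H] [InnerProductSpace ℂ H] :
    IsTraceClass (0 : H →L[ℂ] H) :=
  ⟨fun _ => 0, fun _ => 0, by simp, fun x => by simp [hasSum_zero]⟩

theorem IsTraceClass.smul {H : Type*} [NormedAddCommGroup H] [InnerProductSpace ℂ H]
    {T : H →L[ℂ] H} (c : ℂ) (hT : IsTraceClass T) : IsTraceClass (c • T) := by
  obtain ⟨u, v, hs, h⟩ := hT
  refine ⟨fun n => c • u n, v, ?_, fun x => ?_⟩
  · simpa [norm_smul, mul_assoc] using hs.mul_left ‖c‖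
  · simpa [smul_comm c] using (h x).const_smul c

theorem IsTraceClass.add {H : Type*} [NormedAddCommGroup H] [InnerProductSpace ℂ H]
    {S T : H →L[ℂ] H} (hS : IsTraceClass S) (hT : IsTraceClass T) : IsTraceClass (S + T) := by
  obtain ⟨u, v, hs, h⟩ := hS
  obtain ⟨u', v', hs', h'⟩ := hT
  have e0 (k : ℕ) : Even (2 * k) := even_two_mul k
  have e1 (k : ℕ) : ¬ Even (2 * k + 1) := by simp
  have e2 (k : ℕ) : (2 * k + 1) / 2 = k := by omega
  refine ⟨fun n => if Even n then u (n / 2) else u' (n / 2),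
    fun n => if Even n then v (n / 2) else v' (n / 2), ?_, fun x => ?_⟩
  · refine (HasSum.even_add_odd (m := ∑' n, ‖u n‖ * ‖v n‖)
      (m' := ∑' n, ‖u' n‖ * ‖v' n‖) ?_ ?_).summable
    · simpa [e0] using hs.hasSum
    · simpa only [if_neg (e1 _), e2] using hs'.hasSum
  · rw [add_apply]
    refine HasSum.even_add_odd ?_ ?_
    · simpa [e0] using h x
    · simpa only [if_neg (e1 _), e2] using h' x

/-- The space `𝓣(H)` of trace-class operators on `H`. -/
def TraceClass (H : Type*) [NormedAddCommGroup H] [InnerProductSpace ℂ H] :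
    Submodule ℂ (H →L[ℂ] H) where
  carrier := {T | IsTraceClass T}
  add_mem' := IsTraceClass.add
  zero_mem' := IsTraceClass.zero
  smul_mem' c _ hT := hT.smul c

/-- The index set of a fixed Hilbert basis of `H`. -/
def basisSet (H : Type*) [NormedAddCommGroup H] [InnerProductSpace ℂ H] [CompleteSpace H] :
    Set H :=
  (exists_hilbertBasis ℂ H).choose

/-- A fixed Hilbert basis of `H`. -/
def someBasis (H : Type*) [NormedAddCommGroup H] [InnerProductSpace ℂ H] [CompleteSpace H] :
    HilbertBasis (basisSet H) ℂ H :=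
  (exists_hilbertBasis ℂ H).choose_spec.choose

/-- The trace `tr T = ∑ᵢ ⟨eᵢ, T eᵢ⟩`, to be applied to trace-class operators `T` only; for these it
does not depend on the Hilbert basis. -/
def trace {H : Type*} [NormedAddCommGroup H] [InnerProductSpace ℂ H] [CompleteSpace H]
    (T : H →L[ℂ] H) : ℂ :=
  ∑' i : basisSet H, ⟪someBasis H i, T (someBasis H i)⟫_ℂ

/-- States: positive trace-class operators of trace one. -/
def IsState {H : Type*} [NormedAddCommGroup H] [InnerProductSpace ℂ H] [CompleteSpace H]
    (ρ : TraceClass H) : Prop :=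
  (ρ : H →L[ℂ] H).IsPositive ∧ trace (ρ : H →L[ℂ] H) = 1

/-- Every operator on a finite-dimensional space is trace class. -/
theorem isTraceClass_of_finiteDimensional {H : Type*} [NormedAddCommGroup H]
    [InnerProductSpace ℂ H] [FiniteDimensional ℂ H] (A : H →L[ℂ] H) : IsTraceClass A := by
  let b := stdOrthonormalBasis ℂ H
  let e : ℕ → H := fun n => if h : n < Module.finrank ℂ H then b ⟨n, h⟩ else 0
  have he (n : ℕ) (hn : n ∉ Finset.range (Module.finrank ℂ H)) : e n = 0 := by
    simp only [Finset.mem_range] at hn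
    simp [e, hn]
  refine ⟨fun n => A (e n), e, ?_, fun x => ?_⟩
  · exact summable_of_ne_finset_zero (s := Finset.range (Module.finrank ℂ H))
      (fun n hn => by simp [he n hn])
  · have h1 : A x = ∑ n ∈ Finset.range (Module.finrank ℂ H), ⟪e n, x⟫_ℂ • A (e n) := by
      rw [Finset.sum_range]
      conv_lhs => rw [← b.sum_repr' x]
      simp [e]
    rw [h1]
    exact hasSum_sum_of_ne_finset_zero (fun n hn => by simp [he n hn])

/-! ### Tensor products with a finite-dimensional system -/

/-- If `HS` is finite-dimensional, the algebraic tensor product with a Hilbert space `HA` is already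
complete, so that it is the Hilbert space tensor product. -/
instance completeSpace_tensor {HS HA : Type*} [NormedAddCommGroup HS] [InnerProductSpace ℂ HS]
    [FiniteDimensional ℂ HS] [NormedAddCommGroup HA] [InnerProductSpace ℂ HA] [CompleteSpace HA] :
    CompleteSpace (HS ⊗[ℂ] HA) := by
  let b := stdOrthonormalBasis ℂ HS
  let f : PiLp 2 (fun _ : Fin (Module.finrank ℂ HS) => HA) →ₗ[ℂ] HS ⊗[ℂ] HA :=
    { toFun := fun g => ∑ i, b i ⊗ₜ[ℂ] g i
      map_add' := fun g h => by simp [TensorProduct.tmul_add, Finset.sum_add_distrib]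
      map_smul' := fun c g => by simp [TensorProduct.tmul_smul, Finset.smul_sum] }
  have hinner (g h) : ⟪f g, f h⟫_ℂ = ⟪g, h⟫_ℂ := by
    simp [f, sum_inner, inner_sum, TensorProduct.inner_tmul, PiLp.inner_apply,
      OrthonormalBasis.inner_eq_ite]
  let F := f.isometryOfInner hinner
  have hsurj : Function.Surjective F := by
    intro z
    induction z using TensorProduct.induction_on with
    | zero => exact ⟨0, map_zero F⟩
    | tmul x y =>
      refine ⟨WithLp.toLp 2 (fun i => ⟪b i, x⟫_ℂ • y), ?_⟩
      change ∑ i, b i ⊗ₜ[ℂ] (⟪b i, x⟫_ℂ • y) = x ⊗ₜ[ℂ] y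
      conv_rhs => rw [← b.sum_repr' x]
      simp [TensorProduct.sum_tmul, TensorProduct.tmul_smul, TensorProduct.smul_tmul']
    | add x y hx hy =>
      obtain ⟨g, rfl⟩ := hx
      obtain ⟨h, rfl⟩ := hy
      exact ⟨g + h, map_add F g h⟩
  have := F.isometry.isUniformInducing.isComplete_range (α := _)
  rw [hsurj.range_eq] at this
  exact completeSpace_iff_isComplete_univ.mpr this

theorem IsTraceClass.tensor {HS HA : Type*} [NormedAddCommGroup HS] [InnerProductSpace ℂ HS]
    [FiniteDimensional ℂ HS] [NormedAddCommGroup HA] [InnerProductSpace ℂ HA] [CompleteSpace HA]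
    {T : HS →L[ℂ] HS} {S : HA →L[ℂ] HA} (hT : IsTraceClass T) (hS : IsTraceClass S) :
    IsTraceClass (TensorProduct.mapL T S) := by
  obtain ⟨a, b, hab, hT⟩ := hT
  obtain ⟨u, v, huv, hS⟩ := hS
  let g : ℕ × ℕ → ℝ := fun p => (‖a p.1‖ * ‖b p.1‖) * (‖u p.2‖ * ‖v p.2‖)
  have hg : Summable g :=
    hab.mul_of_nonneg huv (fun _ => by positivity) (fun _ => by positivity)
  let φ : HS ⊗[ℂ] HA → ℕ × ℕ → HS ⊗[ℂ] HA :=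
    fun z p => ⟪b p.1 ⊗ₜ[ℂ] v p.2, z⟫_ℂ • (a p.1 ⊗ₜ[ℂ] u p.2)
  have key (z : HS ⊗[ℂ] HA) : HasSum (φ z) (TensorProduct.mapL T S z) := by
    induction z using TensorProduct.induction_on with
    | zero => simp [φ]
    | tmul x y =>
      have hsum : Summable (φ (x ⊗ₜ[ℂ] y)) := by
        refine Summable.of_norm_bounded (hg.mul_right (‖x‖ * ‖y‖)) (fun p => ?_)
        have h1 := norm_inner_le_norm (𝕜 := ℂ) (b p.1) x
        have h2 := norm_inner_le_norm (𝕜 := ℂ) (v p.2) y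
        calc ‖φ (x ⊗ₜ[ℂ] y) p‖
            = (‖⟪b p.1, x⟫_ℂ‖ * ‖⟪v p.2, y⟫_ℂ‖) * (‖a p.1‖ * ‖u p.2‖) := by
              simp [φ, norm_smul]
          _ ≤ ((‖b p.1‖ * ‖x‖) * (‖v p.2‖ * ‖y‖)) * (‖a p.1‖ * ‖u p.2‖) := by gcongr
          _ = g p * (‖x‖ * ‖y‖) := by simp only [g]; ring
      have hfib (m : ℕ) : HasSum (fun n => φ (x ⊗ₜ[ℂ] y) (m, n))
          ((⟪b m, x⟫_ℂ • a m) ⊗ₜ[ℂ] S y) := by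
        have := (TensorProduct.mkL ℂ HS HA (⟪b m, x⟫_ℂ • a m)).hasSum (hS y)
        simpa [φ, TensorProduct.tmul_smul, ← TensorProduct.smul_tmul', smul_smul, mul_comm]
          using this
      have houter : HasSum (fun m => (⟪b m, x⟫_ℂ • a m) ⊗ₜ[ℂ] S y) (T x ⊗ₜ[ℂ] S y) :=
        ((TensorProduct.mkL ℂ HS HA).flip (S y)).hasSum (hT x)
      have := (hsum.hasSum.prod_fiberwise hfib).unique houter
      rw [TensorProduct.mapL_tmul, ← this]
      exact hsum.hasSum
    | add x y hx hy =>
      simpa [φ, inner_add_right, add_smul] using hx.add hy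
  refine ⟨fun k => a k.unpair.1 ⊗ₜ[ℂ] u k.unpair.2, fun k => b k.unpair.1 ⊗ₜ[ℂ] v k.unpair.2,
    ?_, fun z => ?_⟩
  · have := (Nat.pairEquiv.symm.summable_iff (f := g)).mpr hg
    refine this.congr (fun k => ?_)
    have hk : Nat.pairEquiv.symm k = k.unpair := rfl
    simp only [Function.comp_apply, hk, g, TensorProduct.norm_tmul]
    ring
  · exact (Nat.pairEquiv.symm.hasSum_iff (f := φ z)).mpr (key z)

/-- `T ⊗ S` as a trace-class operator. -/
def TraceClass.tensor {HS HA : Type*} [NormedAddCommGroup HS] [InnerProductSpace ℂ HS]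
    [FiniteDimensional ℂ HS] [NormedAddCommGroup HA] [InnerProductSpace ℂ HA] [CompleteSpace HA]
    (T : TraceClass HS) (S : TraceClass HA) : TraceClass (HS ⊗[ℂ] HA) :=
  ⟨TensorProduct.mapL (T : HS →L[ℂ] HS) (S : HA →L[ℂ] HA), IsTraceClass.tensor T.2 S.2⟩

/-- `R` is the partial trace `tr_A[W]`: `tr[A R] = tr[(A ⊗ 1) W]` for all `A`. -/
def IsPartialTrace {HS HA : Type*} [NormedAddCommGroup HS] [InnerProductSpace ℂ HS]
    [CompleteSpace HS] [FiniteDimensional ℂ HS] [NormedAddCommGroup HA] [InnerProductSpace ℂ HA]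
    [CompleteSpace HA] (W : (HS ⊗[ℂ] HA) →L[ℂ] (HS ⊗[ℂ] HA)) (R : HS →L[ℂ] HS) : Prop :=
  ∀ A : HS →L[ℂ] HS, trace (A * R) = trace (TensorProduct.mapL A (1 : HA →L[ℂ] HA) * W)

/-- The additive quantity `N_S ⊗ 1 + 1 ⊗ N_A`. -/
def additive {HS HA : Type*} [NormedAddCommGroup HS] [InnerProductSpace ℂ HS]
    [NormedAddCommGroup HA] [InnerProductSpace ℂ HA] (NS : HS →L[ℂ] HS) (NA : HA →L[ℂ] HA) :
    (HS ⊗[ℂ] HA) →L[ℂ] (HS ⊗[ℂ] HA) :=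
  TensorProduct.mapL NS 1 + TensorProduct.mapL 1 NA

/-! ### Operations, channels and their duals -/

section Channels

variable {H K : Type*} [NormedAddCommGroup H] [InnerProductSpace ℂ H] [CompleteSpace H]
  [NormedAddCommGroup K] [InnerProductSpace ℂ K] [CompleteSpace K]

/-- Complete positivity: every `id ⊗ Φ` on `n × n` block matrices of trace-class operators maps
positive block operators on `Hⁿ` to positive block operators on `Kⁿ`. -/
def IsCompletelyPositive (Φ : TraceClass H →ₗ[ℂ] TraceClass K) : Prop :=
  ∀ (n : ℕ) (T : Fin n → Fin n → TraceClass H),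
    (∀ v : Fin n → H, 0 ≤ ∑ i, ∑ j, ⟪v i, (T i j : H →L[ℂ] H) (v j)⟫_ℂ) →
    ∀ w : Fin n → K, 0 ≤ ∑ i, ∑ j, ⟪w i, (Φ (T i j) : K →L[ℂ] K) (w j)⟫_ℂ

/-- Operations: completely positive, trace non-increasing linear maps `𝓣(H) → 𝓣(K)`. -/
structure IsOperation (Φ : TraceClass H →ₗ[ℂ] TraceClass K) : Prop where
  completelyPositive : IsCompletelyPositive Φ
  trace_le : ∀ T : TraceClass H, (T : H →L[ℂ] H).IsPositive →
    trace (Φ T : K →L[ℂ] K) ≤ trace (T : H →L[ℂ] H)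

/-- Channels: trace-preserving operations. -/
structure IsChannel (Φ : TraceClass H →ₗ[ℂ] TraceClass K) : Prop extends IsOperation Φ where
  trace_eq : ∀ T : TraceClass H, trace (Φ T : K →L[ℂ] K) = trace (T : H →L[ℂ] H)

open Classical in
/-- The dual `Φ^* : 𝓛(K) → 𝓛(H)`: `Φ^*(A)` is the operator `B` determined by
`tr[B T] = tr[A Φ(T)]` for all trace-class `T`. -/
def dual (Φ : TraceClass H →ₗ[ℂ] TraceClass K) (A : K →L[ℂ] K) : H →L[ℂ] H :=
  if h : ∃ B : H →L[ℂ] H, ∀ T : TraceClass H,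
      trace (B * (T : H →L[ℂ] H)) = trace (A * (Φ T : K →L[ℂ] K))
  then h.choose else 0

/-- `Φ` conserves `N` on average: `tr[N Φ(ρ)] = tr[N ρ]` for all states `ρ`. -/
def ConservesOnAverage (Φ : TraceClass H →ₗ[ℂ] TraceClass H) (N : H →L[ℂ] H) : Prop :=
  ∀ ρ : TraceClass H, IsState ρ →
    trace (N * (Φ ρ : H →L[ℂ] H)) = trace (N * (ρ : H →L[ℂ] H))

end Channels

/-! ### Observables, instruments, measurement schemes -/

/-- Discrete observables on `H` with outcomes in the countable set `X`: positive operators that sum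
to the identity (strongly). -/
structure Observable (X H : Type*) [Countable X] [NormedAddCommGroup H] [InnerProductSpace ℂ H]
    [CompleteSpace H] where
  effect : X → H →L[ℂ] H
  isPositive : ∀ x, (effect x).IsPositive
  hasSum_effect : ∀ v, HasSum (fun x => effect x v) v

/-- Discrete instruments on a finite-dimensional system: operations `𝓘_x` whose sum
`𝓘_X = ∑ₓ 𝓘_x` is a channel. -/
structure Instrument (X HS : Type*) [Countable X] [NormedAddCommGroup HS]
    [InnerProductSpace ℂ HS] [CompleteSpace HS] [FiniteDimensional ℂ HS] where
  op : X → TraceClass HS →ₗ[ℂ] TraceClass HS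
  isOperation : ∀ x, IsOperation (op x)
  total : TraceClass HS →ₗ[ℂ] TraceClass HS
  hasSum_op : ∀ T, HasSum (fun x => (op x T : HS →L[ℂ] HS)) (total T : HS →L[ℂ] HS)
  isChannel : IsChannel total

/-- Measurement schemes `(H_A, ξ, 𝓔, Z)`. -/
structure MeasurementScheme (X HS HA : Type*) [Countable X] [NormedAddCommGroup HS]
    [InnerProductSpace ℂ HS] [CompleteSpace HS] [FiniteDimensional ℂ HS] [NormedAddCommGroup HA]
    [InnerProductSpace ℂ HA] [CompleteSpace HA] where
  ξ : TraceClass HA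
  isState : IsState ξ
  interaction : TraceClass (HS ⊗[ℂ] HA) →ₗ[ℂ] TraceClass (HS ⊗[ℂ] HA)
  isChannel : IsChannel interaction
  pointer : Observable X HA

section Measurement

variable {X Y HS HA : Type*} [Countable X] [Countable Y]
  [NormedAddCommGroup HS] [InnerProductSpace ℂ HS] [CompleteSpace HS] [FiniteDimensional ℂ HS]
  [NormedAddCommGroup HA] [InnerProductSpace ℂ HA] [CompleteSpace HA]

/-- The scheme implements the instrument:
`𝓘_x(T) = tr_A[(1 ⊗ Z(x)) 𝓔(T ⊗ ξ)]` for all `x` and `T`. -/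
def MeasurementScheme.Implements (M : MeasurementScheme X HS HA) (I : Instrument X HS) : Prop :=
  ∀ (x : X) (T : TraceClass HS),
    IsPartialTrace
      (TensorProduct.mapL (1 : HS →L[ℂ] HS) (M.pointer.effect x) *
        (M.interaction (TraceClass.tensor T M.ξ) : (HS ⊗[ℂ] HA) →L[ℂ] (HS ⊗[ℂ] HA)))
      (I.op x T : HS →L[ℂ] HS)

/-- `𝓘` is compatible with `E`, that is, an `E`-instrument: `𝓘_x^*(1) = E(x)`. -/
def Instrument.IsCompatible (I : Instrument X HS) (E : Observable X HS) : Prop :=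
  ∀ x, dual (I.op x) 1 = E.effect x

/-- `𝓘` does not disturb `F`: `𝓘_X^*(F(y)) = F(y)` for all `y`. -/
def Instrument.NotDisturbs (I : Instrument X HS) (F : Observable Y HS) : Prop :=
  ∀ y, dual I.total (F.effect y) = F.effect y

/-- The `E`-instrument `𝓘` is of the first kind: it does not disturb `E` itself. -/
def Instrument.IsFirstKind (I : Instrument X HS) (E : Observable X HS) : Prop :=
  I.NotDisturbs E

open Classical in
/-- Repeatability: `tr[𝓘_y(𝓘_x(ρ))] = δ_{x,y} tr[𝓘_x(ρ)]` for all states `ρ`. -/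
def Instrument.IsRepeatable (I : Instrument X HS) : Prop :=
  ∀ (ρ : TraceClass HS), IsState ρ → ∀ x y,
    trace (I.op y (I.op x ρ) : HS →L[ℂ] HS) =
      if x = y then trace (I.op x ρ : HS →L[ℂ] HS) else 0

/-! ### Fixed states and their support -/

/-- The operator `d⁻¹ 1`, `d = dim HS`. -/
def maximallyMixed (HS : Type*) [NormedAddCommGroup HS] [InnerProductSpace ℂ HS]
    [FiniteDimensional ℂ HS] : TraceClass HS :=
  ⟨(Module.finrank ℂ HS : ℂ)⁻¹ • (1 : HS →L[ℂ] HS), isTraceClass_of_finiteDimensional _⟩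

/-- `ρ₀ = 𝓘_av(d⁻¹ 1)`, where `𝓘_av = lim_N (1/N) ∑_{n=1}^N 𝓘_Xⁿ`. -/
def Instrument.IsAveragedState (I : Instrument X HS) (ρ₀ : HS →L[ℂ] HS) : Prop :=
  Filter.Tendsto
    (fun N : ℕ => (N : ℂ)⁻¹ • ∑ n ∈ Finset.Icc 1 N,
      ((I.total ^ n) (maximallyMixed HS) : HS →L[ℂ] HS))
    Filter.atTop (nhds ρ₀)

/-- `P` is the smallest of the projections `Q` with `ρ = Q ρ Q`. -/
def IsMinSupportProjection (ρ P : HS →L[ℂ] HS) : Prop :=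
  IsLeast {Q : HS →L[ℂ] HS | IsStarProjection Q ∧ ρ = Q * ρ * Q} P

/-- `P` is the smallest of the projections `Q` with `ρ = Q ρ Q` for every fixed state `ρ` of
`𝓘_X`. -/
def Instrument.IsMinFixedSupport (I : Instrument X HS) (P : HS →L[ℂ] HS) : Prop :=
  IsLeast {Q : HS →L[ℂ] HS | IsStarProjection Q ∧
    ∀ ρ : TraceClass HS, IsState ρ → I.total ρ = ρ →
      (ρ : HS →L[ℂ] HS) = Q * (ρ : HS →L[ℂ] HS) * Q} P

/-- `P E P = {P E(x) P : x ∈ X}`. -/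
def Observable.compress (E : Observable X HS) (P : HS →L[ℂ] HS) : X → HS →L[ℂ] HS :=
  fun x => P * E.effect x * P

/-- `𝓘_P^*(A) = P 𝓘_X^*(A) P`. -/
def Instrument.compressedDual (I : Instrument X HS) (P A : HS →L[ℂ] HS) : HS →L[ℂ] HS :=
  P * dual I.total A * P

/-- `𝓘_P^*(P N_S P) - P N_S P`. -/
def Instrument.delta (I : Instrument X HS) (P NS : HS →L[ℂ] HS) : HS →L[ℂ] HS :=
  I.compressedDual P (P * NS * P) - P * NS * P

open Classical in
/-- A family of effects is sharp: `G(x) G(y) = δ_{x,y} G(x)`. -/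
def IsSharp (G : X → HS →L[ℂ] HS) : Prop :=
  ∀ x y, G x * G y = if x = y then G x else 0

end Measurement

end

end WAY

namespace WAY

open InnerProductSpace (rankOne)
open ContinuousLinearMap (adjoint)

/-! ### The trace of trace-class operators -/

/-! Let `Ψ` be the dual of `T ↦ 𝓔(T ⊗ ξ)`, a unital completely positive map from operators on `HS ⊗
HA` to operators on `HS`. It contains everything: `Ψ(A ⊗ 1) = 𝓘_X^*(A)` and `Ψ(A ⊗ Z(x)) =
𝓘_x^*(A)`, so `Ψ(1 ⊗ Z(x)) = E(x)`. Conservation, tested on product states with `ξ`, gives `Ψ(N) =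
N_S + tr[N_A ξ] 1`, so the increment of `P N_S P` is a multiple of `P` minus `P Ψ(1 ⊗ N_A) P`.

The engine is the equality case of the Schwarz inequality. If `Ψ(X) = V^* X V`, then `Ψ(X^*X) -
Ψ(X^*)C - C^*Ψ(X) + C^*C` is `(XV - VC)^*(XV - VC)`. When its expectation in `ρ₀` is zero, `XV = VC`
on the range of `P`, hence `Ψ(YX)P = Ψ(Y)CP` (`IsRankOneChannel.dualLin_mul_support`). Invariance of
`ρ₀` makes this apply to `X = A ⊗ 1`, `C = A` whenever `A` is fixed by the compressed dual. So `P
Ψ(·) P` is a bimodule map over such `A`, and these commute with `P Ψ(Y) P` for every `Y` commuting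
with `A ⊗ 1` (`IsCompressedFixed.commute`).

Taking `Y = 1 ⊗ Z(x)` and `Y = 1 ⊗ N_A` yields (i). For (ii), put `A = P E(x) P`. As `A` commutes
with the increment, `[A, P N_S P]` is itself a fixed point, so it commutes with `P Ψ(1 ⊗ Z(x)) P =
A`; a vanishing double commutator of self-adjoint matrices forces a vanishing commutator. For (iii),
repeatability says `𝓘_x^*(E(y)) = δ_{x,y} E(x)`; summing over `x` gives the first kind, and the
bimodule property turns `P E(x) P · P E(y) P` into `P 𝓘_y^*(E(x)) P`. -/

theorem summable_norm_inner_mul_inner {ι H : Type*} [NormedAddCommGroup H] [InnerProductSpace ℂ H]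
    {b : ι → H} (hb : Orthonormal ℂ b) (x y : H) :
    Summable (fun i => ‖⟪x, b i⟫_ℂ‖ * ‖⟪b i, y⟫_ℂ‖) ∧
      ∑' i, ‖⟪x, b i⟫_ℂ‖ * ‖⟪b i, y⟫_ℂ‖ ≤ ‖x‖ * ‖y‖ := by
  have key (s : Finset ι) : ∑ i ∈ s, ‖⟪x, b i⟫_ℂ‖ * ‖⟪b i, y⟫_ℂ‖ ≤ ‖x‖ * ‖y‖ := by
    refine abs_le_of_sq_le_sq' ?_ (by positivity) |>.2
    calc _ ≤ (∑ i ∈ s, ‖⟪x, b i⟫_ℂ‖ ^ 2) * ∑ i ∈ s, ‖⟪b i, y⟫_ℂ‖ ^ 2 :=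
          Finset.sum_mul_sq_le_sq_mul_sq _ _ _
      _ ≤ ‖x‖ ^ 2 * ‖y‖ ^ 2 := by
          gcongr
          · simp_rw [norm_inner_symm x]
            exact hb.sum_inner_products_le x
          · exact hb.sum_inner_products_le y
      _ = _ := by ring
  have hs := summable_of_sum_le (fun i => by positivity) key
  exact ⟨hs, hs.tsum_le_of_sum_le key⟩

section Hilbert

variable {H : Type*} [NormedAddCommGroup H] [InnerProductSpace ℂ H] [CompleteSpace H]

omit [CompleteSpace H] in
-- Fubini for the double family indexed by the decomposition of `T` and the basis: Bessel gives
-- absolute summability, and Parseval evaluates the sum over the basis. The value does not depend on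
-- the basis.
theorem hasSum_trace_aux {ι : Type*} (b : HilbertBasis ι ℂ H) {T : H →L[ℂ] H} {u v : ℕ → H}
    (hs : Summable (fun n => ‖u n‖ * ‖v n‖)) (h : ∀ x, HasSum (fun n => ⟪v n, x⟫_ℂ • u n) (T x)) :
    HasSum (fun i => ⟪b i, T (b i)⟫_ℂ) (∑' n, ⟪v n, u n⟫_ℂ) := by
  have hsum : Summable (fun p : ℕ × ι => ⟪v p.1, b p.2⟫_ℂ * ⟪b p.2, u p.1⟫_ℂ) := by
    refine Summable.of_norm ?_
    simp_rw [norm_mul]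
    rw [summable_prod_of_nonneg (fun _ => by positivity)]
    refine ⟨fun n => (summable_norm_inner_mul_inner b.orthonormal (v n) (u n)).1, ?_⟩
    refine Summable.of_nonneg_of_le (fun n => tsum_nonneg fun i => by positivity) (fun n => ?_) hs
    rw [mul_comm]
    exact (summable_norm_inner_mul_inner b.orthonormal (v n) (u n)).2
  have h1 := hsum.hasSum.prod_fiberwise fun n => b.hasSum_inner_mul_inner (v n) (u n)
  rw [h1.tsum_eq]
  refine ((Equiv.prodComm ι ℕ).hasSum_iff.mpr hsum.hasSum).prod_fiberwise fun i => ?_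
  simpa [inner_smul_right] using (h (b i)).mapL (innerSL ℂ (b i))

theorem IsTraceClass.hasSum_basis {T : H →L[ℂ] H} (hT : IsTraceClass T) :
    HasSum (fun i => ⟪someBasis H i, T (someBasis H i)⟫_ℂ) (trace T) := by
  obtain ⟨u, v, hs, h⟩ := hT
  exact (hasSum_trace_aux _ hs h).summable.hasSum

omit [CompleteSpace H] in
theorem summable_inner_of_summable_norm {u v : ℕ → H} (hs : Summable (fun n => ‖u n‖ * ‖v n‖)) :
    Summable (fun n => ⟪v n, u n⟫_ℂ) :=
  Summable.of_norm_bounded hs fun n => by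
    rw [mul_comm]
    exact norm_inner_le_norm _ _

theorem hasSum_trace {T : H →L[ℂ] H} {u v : ℕ → H}
    (hs : Summable (fun n => ‖u n‖ * ‖v n‖)) (h : ∀ x, HasSum (fun n => ⟪v n, x⟫_ℂ • u n) (T x)) :
    HasSum (fun n => ⟪v n, u n⟫_ℂ) (trace T) := by
  rw [show trace T = _ from (hasSum_trace_aux (someBasis H) hs h).tsum_eq]
  exact (summable_inner_of_summable_norm hs).hasSum

omit [CompleteSpace H] in
theorem summable_norm_apply_left (B : H →L[ℂ] H) {u v : ℕ → H}
    (hs : Summable (fun n => ‖u n‖ * ‖v n‖)) : Summable (fun n => ‖B (u n)‖ * ‖v n‖) := by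
  refine Summable.of_nonneg_of_le (fun n => by positivity) (fun n => ?_) (hs.mul_left ‖B‖)
  rw [← mul_assoc]
  gcongr
  exact B.le_opNorm _

omit [CompleteSpace H] in
theorem summable_norm_apply_right (B : H →L[ℂ] H) {u v : ℕ → H}
    (hs : Summable (fun n => ‖u n‖ * ‖v n‖)) : Summable (fun n => ‖u n‖ * ‖B (v n)‖) := by
  simp_rw [mul_comm ‖u _‖] at hs ⊢
  exact summable_norm_apply_left B hs

theorem hasSum_trace_mul {T : H →L[ℂ] H} {u v : ℕ → H} (B : H →L[ℂ] H)
    (hs : Summable (fun n => ‖u n‖ * ‖v n‖)) (h : ∀ x, HasSum (fun n => ⟪v n, x⟫_ℂ • u n) (T x)) :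
    HasSum (fun n => ⟪v n, B (u n)⟫_ℂ) (trace (B * T)) :=
  hasSum_trace (summable_norm_apply_left B hs) fun x => by simpa using (h x).mapL B

omit [CompleteSpace H] in
theorem IsTraceClass.mul_left {T : H →L[ℂ] H} (hT : IsTraceClass T) (B : H →L[ℂ] H) :
    IsTraceClass (B * T) := by
  obtain ⟨u, v, hs, h⟩ := hT
  exact ⟨_, v, summable_norm_apply_left B hs, fun x => by simpa using (h x).mapL B⟩

theorem IsTraceClass.mul_right {T : H →L[ℂ] H} (hT : IsTraceClass T) (B : H →L[ℂ] H) :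
    IsTraceClass (T * B) := by
  obtain ⟨u, v, hs, h⟩ := hT
  exact ⟨u, _, summable_norm_apply_right (adjoint B) hs, fun x => by
    simpa [ContinuousLinearMap.adjoint_inner_left] using h (B x)⟩

/-- Both sides are `∑ ⟨vₙ, B uₙ⟩`, since `T B = ∑ |uₙ⟩⟨B^* vₙ|`. -/
theorem trace_mul_comm {T : H →L[ℂ] H} (hT : IsTraceClass T) (B : H →L[ℂ] H) :
    trace (B * T) = trace (T * B) := by
  obtain ⟨u, v, hs, h⟩ := hT
  refine (hasSum_trace_mul B hs h).unique ?_
  have := hasSum_trace (T := T * B) (summable_norm_apply_right (adjoint B) hs) fun x => by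
    simpa [ContinuousLinearMap.adjoint_inner_left] using h (B x)
  simpa [ContinuousLinearMap.adjoint_inner_left] using this

theorem trace_add {S T : H →L[ℂ] H} (hS : IsTraceClass S) (hT : IsTraceClass T) :
    trace (S + T) = trace S + trace T :=
  (hS.add hT).hasSum_basis.unique (by
    simpa [inner_add_right] using hS.hasSum_basis.add hT.hasSum_basis)

theorem trace_smul (c : ℂ) {T : H →L[ℂ] H} (hT : IsTraceClass T) :
    trace (c • T) = c * trace T :=
  (hT.smul c).hasSum_basis.unique (by
    simpa [inner_smul_right] using hT.hasSum_basis.mul_left c)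

/-- The functional `W ↦ tr[X W]` on trace-class operators. -/
noncomputable def traceMul (H : Type*) [NormedAddCommGroup H] [InnerProductSpace ℂ H]
    [CompleteSpace H] : (H →L[ℂ] H) →ₗ[ℂ] TraceClass H →ₗ[ℂ] ℂ :=
  LinearMap.mk₂ ℂ (fun X W => trace (X * (W : H →L[ℂ] H)))
    (fun X Y W => by rw [add_mul, trace_add (W.2.mul_left X) (W.2.mul_left Y)])
    (fun c X W => by rw [smul_mul_assoc, trace_smul c (W.2.mul_left X), smul_eq_mul])
    (fun X V W => by
      rw [Submodule.coe_add, mul_add, trace_add (V.2.mul_left X) (W.2.mul_left X)])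
    (fun c X W => by
      rw [Submodule.coe_smul, mul_smul_comm, trace_smul c (W.2.mul_left X), smul_eq_mul])

theorem traceMul_apply (X : H →L[ℂ] H) (W : TraceClass H) :
    traceMul H X W = trace (X * (W : H →L[ℂ] H)) := rfl

/-- Dominated convergence. Bounded strong convergence is all that is available for the pointer,
whose effects sum to `1` only strongly. -/
theorem tendsto_trace_mul {ι : Type*} {l : Filter ι} {B : ι → H →L[ℂ] H} {B₀ : H →L[ℂ] H} {C : ℝ}
    (hC : ∀ i, ‖B i‖ ≤ C) (hB : ∀ x, Filter.Tendsto (fun i => B i x) l (nhds (B₀ x)))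
    (W : TraceClass H) :
    Filter.Tendsto (fun i => trace (B i * (W : H →L[ℂ] H))) l
      (nhds (trace (B₀ * (W : H →L[ℂ] H)))) := by
  obtain ⟨u, v, hs, h⟩ := W.2
  simp_rw [← (hasSum_trace_mul _ hs h).tsum_eq]
  refine tendsto_tsum_of_dominated_convergence (hs.mul_left C)
    (fun n => tendsto_const_nhds.inner (hB (u n))) (Filter.Eventually.of_forall fun i n => ?_)
  calc ‖⟪v n, B i (u n)⟫_ℂ‖ ≤ ‖v n‖ * (‖B i‖ * ‖u n‖) :=
        (norm_inner_le_norm _ _).trans (by gcongr; exact (B i).le_opNorm _)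
    _ ≤ ‖v n‖ * (C * ‖u n‖) := by gcongr; exact hC i
    _ = C * (‖u n‖ * ‖v n‖) := by ring

omit [CompleteSpace H] in
theorem isTraceClass_rankOne (a b : H) : IsTraceClass (rankOne ℂ a b) := by
  refine ⟨Pi.single 0 a, Pi.single 0 b, ?_, fun x => ?_⟩
  · exact summable_of_ne_finset_zero (s := {0}) fun n hn => by
      simp [Pi.single_eq_of_ne (Finset.notMem_singleton.mp hn)]
  · convert hasSum_single (f := fun n => ⟪(Pi.single 0 b : ℕ → H) n, x⟫_ℂ •
      (Pi.single 0 a : ℕ → H) n) 0 fun n hn => by simp [Pi.single_eq_of_ne hn] using 1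
    simp

theorem trace_mul_rankOne (B : H →L[ℂ] H) (a b : H) :
    trace (B * rankOne ℂ a b) = ⟪b, B a⟫_ℂ := by
  have hB : B * rankOne ℂ a b = rankOne ℂ (B a) b := by ext; simp
  rw [hB]
  refine ((isTraceClass_rankOne (B a) b).hasSum_basis).unique ?_
  simpa [inner_smul_right] using (someBasis H).hasSum_inner_mul_inner b (B a)

theorem trace_rankOne (a b : H) : trace (rankOne ℂ a b) = ⟪b, a⟫_ℂ := by
  simpa using trace_mul_rankOne 1 a b

end Hilbert

/-! ### Trace duality in finite dimension -/

section FiniteDim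

variable {H : Type*} [NormedAddCommGroup H] [InnerProductSpace ℂ H] [FiniteDimensional ℂ H]

/-- In finite dimension every operator is trace class. -/
noncomputable def toTraceClass (H : Type*) [NormedAddCommGroup H] [InnerProductSpace ℂ H]
    [FiniteDimensional ℂ H] : (H →L[ℂ] H) →ₗ[ℂ] TraceClass H :=
  LinearMap.codRestrict _ LinearMap.id fun A => isTraceClass_of_finiteDimensional A

@[simp] theorem coe_toTraceClass (A : H →L[ℂ] H) : (toTraceClass H A : H →L[ℂ] H) = A := rfl

variable [CompleteSpace H]

omit [FiniteDimensional ℂ H] in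
theorem eq_of_trace_mul_eq {A B : H →L[ℂ] H}
    (h : ∀ T : H →L[ℂ] H, trace (A * T) = trace (B * T)) : A = B := by
  ext x
  refine ext_inner_left ℂ fun y => ?_
  simpa [trace_mul_rankOne] using h (rankOne ℂ x y)

theorem exists_trace_mul_eq (f : (H →L[ℂ] H) →ₗ[ℂ] ℂ) :
    ∃ B : H →L[ℂ] H, ∀ T, trace (B * T) = f T := by
  let g : (H →L[ℂ] H) →ₗ[ℂ] Module.Dual ℂ (H →L[ℂ] H) :=
    (LinearMap.lcomp ℂ ℂ (toTraceClass H)) ∘ₗ traceMul H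
  have hg : Function.Injective g := fun A B h =>
    eq_of_trace_mul_eq fun T => LinearMap.congr_fun h T
  obtain ⟨B, hB⟩ := (LinearMap.injective_iff_surjective_of_finrank_eq_finrank
    Subspace.dual_finrank_eq.symm).mp hg f
  exact ⟨B, fun T => LinearMap.congr_fun hB T⟩

/-- The trace pairing on a finite-dimensional `H` represents every functional, so the default value
`0` in `dual` never occurs, even when `K` is infinite-dimensional. -/
theorem trace_dual_mul {K : Type*} [NormedAddCommGroup K] [InnerProductSpace ℂ K] [CompleteSpace K]
    (Θ : TraceClass H →ₗ[ℂ] TraceClass K) (A : K →L[ℂ] K) (T : TraceClass H) :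
    trace (dual Θ A * (T : H →L[ℂ] H)) = trace (A * (Θ T : K →L[ℂ] K)) := by
  have h : ∃ B : H →L[ℂ] H, ∀ T : TraceClass H,
      trace (B * (T : H →L[ℂ] H)) = trace (A * (Θ T : K →L[ℂ] K)) := by
    obtain ⟨B, hB⟩ := exists_trace_mul_eq (traceMul K A ∘ₗ Θ ∘ₗ toTraceClass H)
    exact ⟨B, fun T => hB T⟩
  rw [dual, dif_pos h]
  exact h.choose_spec T

theorem eq_dual_iff {K : Type*} [NormedAddCommGroup K] [InnerProductSpace ℂ K] [CompleteSpace K]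
    {Θ : TraceClass H →ₗ[ℂ] TraceClass K} {A : K →L[ℂ] K} {B : H →L[ℂ] H} :
    B = dual Θ A ↔ ∀ T : TraceClass H,
      trace (B * (T : H →L[ℂ] H)) = trace (A * (Θ T : K →L[ℂ] K)) := by
  refine ⟨fun h T => h ▸ trace_dual_mul Θ A T, fun h => eq_of_trace_mul_eq fun T => ?_⟩
  exact (h (toTraceClass H T)).trans (trace_dual_mul Θ A (toTraceClass H T)).symm

/-- The trace as a linear functional on the operators of a finite-dimensional space. -/
noncomputable def traceLin (H : Type*) [NormedAddCommGroup H] [InnerProductSpace ℂ H]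
    [CompleteSpace H] [FiniteDimensional ℂ H] : (H →L[ℂ] H) →ₗ[ℂ] ℂ :=
  traceMul H 1 ∘ₗ toTraceClass H

@[simp] theorem traceLin_apply (A : H →L[ℂ] H) : traceLin H A = trace A := by
  simp [traceLin, traceMul_apply]

end FiniteDim

/-! ### Positive operators in finite dimension -/

section Positive

variable {H : Type*} [NormedAddCommGroup H] [InnerProductSpace ℂ H] [FiniteDimensional ℂ H]

theorem apply_eq_zero_of_inner_eq_zero {D : H →L[ℂ] H} (hD : D.IsPositive) {x : H}
    (hx : ⟪x, D x⟫_ℂ = 0) : D x = 0 := by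
  obtain ⟨m, u, rfl⟩ := ContinuousLinearMap.isPositive_iff_eq_sum_rankOne.mp hD
  simp only [sum_apply, InnerProductSpace.rankOne_apply, inner_sum,
    inner_smul_right] at hx ⊢
  have h (i : Fin m) : ⟪u i, x⟫_ℂ * ⟪x, u i⟫_ℂ = ((‖⟪u i, x⟫_ℂ‖ ^ 2 : ℝ) : ℂ) := by
    rw [← inner_conj_symm x (u i), RCLike.mul_conj]
    norm_cast
  simp_rw [h] at hx
  rw [← Complex.ofReal_sum, Complex.ofReal_eq_zero,
    Finset.sum_eq_zero_iff_of_nonneg fun _ _ => by positivity] at hx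
  exact Finset.sum_eq_zero fun i hi => by
    simp [norm_eq_zero.mp (pow_eq_zero_iff two_ne_zero |>.mp (hx i hi))]

variable [CompleteSpace H]

theorem trace_sum_rankOne (D : H →L[ℂ] H) {m : ℕ} (u : Fin m → H) :
    trace (D * ∑ i, rankOne ℂ (u i) (u i)) = ∑ i, ⟪u i, D (u i)⟫_ℂ := by
  rw [Finset.mul_sum, ← traceLin_apply, map_sum]
  simp [trace_mul_rankOne]

theorem mul_eq_zero_of_trace_mul_eq_zero {D ρ : H →L[ℂ] H} (hD : D.IsPositive) (hρ : ρ.IsPositive)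
    (h : trace (D * ρ) = 0) : D * ρ = 0 := by
  obtain ⟨m, u, rfl⟩ := ContinuousLinearMap.isPositive_iff_eq_sum_rankOne.mp hρ
  rw [trace_sum_rankOne, Finset.sum_eq_zero_iff_of_nonneg fun i _ => hD.inner_nonneg_right _] at h
  rw [Finset.mul_sum]
  refine Finset.sum_eq_zero fun i hi => ?_
  ext x
  simp [apply_eq_zero_of_inner_eq_zero hD (h i hi)]

theorem norm_le_re_trace {T : H →L[ℂ] H} (hT : T.IsPositive) : ‖T‖ ≤ (trace T).re := by
  obtain ⟨m, u, rfl⟩ := ContinuousLinearMap.isPositive_iff_eq_sum_rankOne.mp hT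
  have h := trace_sum_rankOne 1 u
  rw [one_mul] at h
  rw [h, Complex.re_sum]
  refine (norm_sum_le _ _).trans (Finset.sum_le_sum fun i _ => ?_)
  have := inner_self_eq_norm_mul_norm (𝕜 := ℂ) (u i)
  simp_all

omit [FiniteDimensional ℂ H] [CompleteSpace H] in
theorem isPositive_of_inner_nonneg {T : H →L[ℂ] H} (h : ∀ x, 0 ≤ ⟪x, T x⟫_ℂ) : T.IsPositive := by
  refine (ContinuousLinearMap.isPositive_iff_complex T).mpr fun x => ?_
  have h1 : 0 ≤ ⟪T x, x⟫_ℂ := by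
    rw [← inner_conj_symm]
    exact star_nonneg_iff.mpr (h x)
  have h2 := RCLike.nonneg_iff.mp h1
  exact ⟨RCLike.conj_eq_iff_re.mp (RCLike.conj_eq_iff_im.mpr h2.2), h2.1⟩

/-- `B = [A, N]` is anti-self-adjoint, and because `A` commutes with `B`, `B^*B = (NB)A - A(NB)` is
a commutator. It has trace zero, so `B = 0`. -/
theorem commute_of_commute_commutator {A N : H →L[ℂ] H} (hA : IsSelfAdjoint A)
    (hN : IsSelfAdjoint N) (h : Commute A (A * N - N * A)) : Commute A N := by
  set B := A * N - N * A with hB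
  have hstar : star B = -B := by
    simp [hB, star_mul, hA.star_eq, hN.star_eq]
  have htr : trace (star B * B * 1) = 0 := by
    have h1 : trace (N * B * A) = trace (A * (N * B)) :=
      (trace_mul_comm (isTraceClass_of_finiteDimensional _) A).symm
    have h2 : star B * B * 1 = N * B * A - A * (N * B) := by
      rw [hstar, mul_one, mul_assoc N B A, ← h.eq]
      nth_rw 1 [hB]
      noncomm_ring
    rw [h2, ← traceLin_apply, map_sub, traceLin_apply, traceLin_apply, h1, sub_self]
  have hpos : (star B * B).IsPositive := by
    rw [ContinuousLinearMap.star_eq_adjoint]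
    exact ContinuousLinearMap.isPositive_adjoint_comp_self B
  have := mul_eq_zero_of_trace_mul_eq_zero hpos ContinuousLinearMap.isPositive_one htr
  rw [mul_one, CStarRing.star_mul_self_eq_zero_iff] at this
  exact sub_eq_zero.mp this

/-- `P` is the support projection of `ρ`. -/
structure IsSupport (ρ P : H →L[ℂ] H) : Prop where
  isPositive : ρ.IsPositive
  isStarProjection : IsStarProjection P
  mul_eq : P * ρ = ρ
  mul_eq_zero : ∀ D : H →L[ℂ] H, D * ρ = 0 → D * P = 0

theorem exists_isSupport {ρ : H →L[ℂ] H} (hρ : ρ.IsPositive) : ∃ P, IsSupport ρ P := by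
  refine ⟨(LinearMap.range (ρ : H →ₗ[ℂ] H)).starProjection, hρ,
    isStarProjection_starProjection, ?_, fun D hD => ?_⟩
  · ext x
    exact Submodule.starProjection_eq_self_iff.mpr ⟨x, rfl⟩
  · ext x
    obtain ⟨y, hy⟩ := (LinearMap.range (ρ : H →ₗ[ℂ] H)).starProjection_apply_mem x
    have := congr($hD y)
    simpa [← hy] using this

omit [FiniteDimensional ℂ H] in
theorem IsSupport.mul_eq_right {ρ P : H →L[ℂ] H} (h : IsSupport ρ P) : ρ * P = ρ := by
  have := congr(star $(h.mul_eq))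
  rwa [star_mul, h.isPositive.isSelfAdjoint.star_eq, h.isStarProjection.isSelfAdjoint.star_eq]
    at this

omit [FiniteDimensional ℂ H] in
theorem IsSupport.isMinSupportProjection {ρ P : H →L[ℂ] H} (h : IsSupport ρ P) :
    IsMinSupportProjection ρ P := by
  refine ⟨⟨h.isStarProjection, by rw [h.mul_eq, h.mul_eq_right]⟩, fun Q ⟨hQ, hρ⟩ => ?_⟩
  refine h.isStarProjection.le_of_mul_eq_right hQ ?_
  have : (1 - Q) * P = 0 := h.mul_eq_zero _ (by
    rw [hρ, ← mul_assoc, ← mul_assoc, hQ.one_sub_mul_self, zero_mul, zero_mul])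
  rw [sub_mul, one_mul, sub_eq_zero] at this
  exact this.symm

/-- Domination by a multiple of `ρ₀` gives `ker ρ₀ ⊆ ker ρ`, and `1 - P` maps into `ker ρ₀`. -/
theorem mul_mul_eq_of_le {ρ₀ ρ P : H →L[ℂ] H} (h : IsSupport ρ₀ P) (hρ : ρ.IsPositive) (c : ℂ)
    (hle : (c • ρ₀ - ρ).IsPositive) : ρ = P * ρ * P := by
  have hP := h.isStarProjection.isSelfAdjoint
  have key : ρ * (1 - P) = 0 := by
    have hker (y : H) (hy : ρ₀ y = 0) : ρ y = 0 := by
      refine apply_eq_zero_of_inner_eq_zero hρ (le_antisymm ?_ (hρ.inner_nonneg_right _))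
      simpa [hy] using hle.inner_nonneg_right y
    ext x
    refine hker ((1 - P) x) ?_
    have h0 : ρ₀ * (1 - P) = 0 := by rw [mul_sub, mul_one, h.mul_eq_right, sub_self]
    exact congr($h0 x)
  have h1 : ρ * P = ρ := by
    rw [mul_sub, mul_one, sub_eq_zero] at key
    exact key.symm
  have h2 := congr(star $h1)
  rw [star_mul, hρ.isSelfAdjoint.star_eq, hP.star_eq] at h2
  rw [h2, h1]

end Positive

/-! ### The Schwarz inequality and its equality case -/

/-- Imaginary parts vanish at `t = ±1, ±i`; differences within each pair eliminate `g` and `c`. -/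
theorem star_eq_of_forall_nonneg {g a b c : ℂ}
    (h : ∀ t : ℂ, 0 ≤ g + star t * a + t * b + star t * t * c) : b = star a := by
  have h1 := (Complex.nonneg_iff.mp (h 1)).2
  have h2 := (Complex.nonneg_iff.mp (h (-1))).2
  have h3 := (Complex.nonneg_iff.mp (h Complex.I)).2
  have h4 := (Complex.nonneg_iff.mp (h (-Complex.I))).2
  simp at h1 h2 h3 h4
  apply Complex.ext <;> simp <;> linarith

theorem eq_zero_of_forall_nonneg {a b c : ℂ}
    (h : ∀ t : ℂ, 0 ≤ star t * a + t * b + star t * t * c) : a = 0 := by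
  have hb : b = star a := star_eq_of_forall_nonneg (g := 0) (c := c) (by simpa using h)
  by_contra ha
  have hn : 0 < Complex.normSq a := Complex.normSq_pos.mpr ha
  have key (s : ℝ) : 0 ≤ Complex.normSq a * (-2 * s + s ^ 2 * c.re) := by
    have := (Complex.nonneg_iff.mp (h (-(s : ℂ) * a))).1
    simp [hb, Complex.normSq_apply] at this ⊢
    ring_nf at this ⊢
    linarith
  -- For `s = 1 / (|Re c| + 1)` one has `s² Re c ≤ s`, so `-2s + s² Re c ≤ -s < 0`: near `0` the
  -- linear term wins.
  have h1 := nonneg_of_mul_nonneg_right (key (1 / (|c.re| + 1))) hn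
  have hpos : 0 < |c.re| + 1 := by positivity
  have h2 : (1 / (|c.re| + 1)) ^ 2 * c.re ≤ 1 / (|c.re| + 1) := by
    rw [div_pow, one_pow, div_mul_eq_mul_div, one_mul, div_le_div_iff₀ (by positivity) hpos]
    nlinarith [le_abs_self c.re, abs_nonneg c.re]
  have : 0 < 1 / (|c.re| + 1) := by positivity
  linarith

section Schwarz

variable {H K : Type*} [NormedAddCommGroup H] [InnerProductSpace ℂ H] [FiniteDimensional ℂ H]
  [CompleteSpace H] [NormedAddCommGroup K] [InnerProductSpace ℂ K] [CompleteSpace K]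

/-- Complete positivity on block operators `|vᵢ⟩⟨vⱼ|` together with preservation of the trace. -/
structure IsRankOneChannel (Θ : TraceClass H →ₗ[ℂ] TraceClass K) : Prop where
  nonneg : ∀ (n : ℕ) (v : Fin n → H) (w : Fin n → K),
    0 ≤ ∑ i, ∑ j, ⟪w i, (Θ (toTraceClass H (rankOne ℂ (v i) (v j))) : K →L[ℂ] K) (w j)⟫_ℂ
  trace_eq : ∀ T : TraceClass H, trace (Θ T : K →L[ℂ] K) = trace (T : H →L[ℂ] H)

theorem dual_add (Θ : TraceClass H →ₗ[ℂ] TraceClass K) (X Y : K →L[ℂ] K) :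
    dual Θ (X + Y) = dual Θ X + dual Θ Y := by
  refine (eq_dual_iff.mpr fun T => ?_).symm
  simp only [← traceMul_apply, map_add, LinearMap.add_apply]
  simp only [traceMul_apply, trace_dual_mul]

theorem dual_smul (Θ : TraceClass H →ₗ[ℂ] TraceClass K) (c : ℂ) (X : K →L[ℂ] K) :
    dual Θ (c • X) = c • dual Θ X := by
  refine (eq_dual_iff.mpr fun T => ?_).symm
  simp only [← traceMul_apply, map_smul, LinearMap.smul_apply]
  simp only [traceMul_apply, trace_dual_mul]

/-- `X ↦ Θ^*(X)` as a linear map. -/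
noncomputable def dualLin (Θ : TraceClass H →ₗ[ℂ] TraceClass K) :
    (K →L[ℂ] K) →ₗ[ℂ] (H →L[ℂ] H) where
  toFun := dual Θ
  map_add' := dual_add Θ
  map_smul' := dual_smul Θ

theorem dualLin_apply (Θ : TraceClass H →ₗ[ℂ] TraceClass K) (X : K →L[ℂ] K) :
    dualLin Θ X = dual Θ X := rfl

theorem inner_dualLin (Θ : TraceClass H →ₗ[ℂ] TraceClass K) (X : K →L[ℂ] K) (v w : H) :
    ⟪v, dualLin Θ X w⟫_ℂ = trace (X * (Θ (toTraceClass H (rankOne ℂ w v)) : K →L[ℂ] K)) := by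
  rw [dualLin_apply, ← trace_mul_rankOne, ← trace_dual_mul, coe_toTraceClass]

variable {Θ : TraceClass H →ₗ[ℂ] TraceClass K} (hΘ : IsRankOneChannel Θ)
include hΘ

theorem IsRankOneChannel.dualLin_one : dualLin Θ 1 = 1 :=
  (eq_dual_iff.mpr fun T => by rw [one_mul, one_mul, hΘ.trace_eq]).symm

/-- Complete positivity passes to the dual: expanding the traces in a Hilbert basis `eₖ` of `K`,
each term is the hypothesis at the vectors `Xᵢ^* eₖ`. -/
theorem IsRankOneChannel.dualLin_nonneg (n : ℕ) (X : Fin n → K →L[ℂ] K) (v : Fin n → H) :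
    0 ≤ ∑ i, ∑ j, ⟪v i, dualLin Θ (star (X i) * X j) (v j)⟫_ℂ := by
  have h (i j : Fin n) :=
    ((((Θ (toTraceClass H (rankOne ℂ (v j) (v i)))).2.mul_left (X j)).mul_right
      (star (X i))).hasSum_basis)
  have hsum := hasSum_sum (s := Finset.univ) fun i _ =>
    hasSum_sum (s := Finset.univ) fun j _ => h i j
  have heq : ∑ i, ∑ j, ⟪v i, dualLin Θ (star (X i) * X j) (v j)⟫_ℂ =
      ∑ i, ∑ j, trace (X j * (Θ (toTraceClass H (rankOne ℂ (v j) (v i))) : K →L[ℂ] K) *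
        star (X i)) := by
    refine Finset.sum_congr rfl fun i _ => Finset.sum_congr rfl fun j _ => ?_
    rw [inner_dualLin, mul_assoc,
      trace_mul_comm ((Θ (toTraceClass H (rankOne ℂ (v j) (v i)))).2.mul_left (X j))]
  rw [heq]
  refine hsum.nonneg fun k => ?_
  have := hΘ.nonneg n v fun i => star (X i) (someBasis K k)
  rw [Finset.sum_comm] at this
  refine this.trans_eq ?_
  refine Finset.sum_congr rfl fun i _ => Finset.sum_congr rfl fun j _ => ?_
  simp [ContinuousLinearMap.star_eq_adjoint, ContinuousLinearMap.adjoint_inner_left]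

theorem IsRankOneChannel.dualLin_star (X : K →L[ℂ] K) :
    dualLin Θ (star X) = star (dualLin Θ X) := by
  ext v
  refine ext_inner_left ℂ fun w => ?_
  have := star_eq_of_forall_nonneg (g := ⟪w, dualLin Θ (star X * X) w⟫_ℂ)
    (a := ⟪v, dualLin Θ X w⟫_ℂ) (b := ⟪w, dualLin Θ (star X) v⟫_ℂ) (c := ⟪v, v⟫_ℂ) fun t => by
      have := hΘ.dualLin_nonneg 2 ![X, 1] ![w, t • v]
      simp [Fin.sum_univ_two, hΘ.dualLin_one] at this
      refine this.trans_eq ?_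
      simp
      ring
  rw [this, ContinuousLinearMap.star_eq_adjoint, ContinuousLinearMap.adjoint_inner_right]
  exact inner_conj_symm _ _

/-- The operator measuring the failure of `X V = V C` for a Stinespring isometry `V`. -/
theorem IsRankOneChannel.isPositive_defect (X : K →L[ℂ] K) (C : H →L[ℂ] H) :
    (dualLin Θ (star X * X) - dualLin Θ (star X) * C - star C * dualLin Θ X
      + star C * C).IsPositive := by
  refine isPositive_of_inner_nonneg fun v => ?_
  have := hΘ.dualLin_nonneg 2 ![X, 1] ![v, -C v]
  simp [Fin.sum_univ_two, hΘ.dualLin_one] at this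
  refine this.trans_eq ?_
  simp [ContinuousLinearMap.star_eq_adjoint, ContinuousLinearMap.adjoint_inner_right]
  ring

/-- This is `XVv = VCv` multiplied by `V^* Y`, proved without a dilation. Adjoining `Y^*` with the
vector `t w` to the positive block leaves no constant term in `t`, so the linear coefficient must
vanish. -/
theorem IsRankOneChannel.dualLin_mul_apply {X : K →L[ℂ] K} {C : H →L[ℂ] H} {v : H}
    (h : (dualLin Θ (star X * X) - dualLin Θ (star X) * C - star C * dualLin Θ X
      + star C * C) v = 0) (Y : K →L[ℂ] K) :
    dualLin Θ (Y * X) v = dualLin Θ Y (C v) := by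
  refine ext_inner_left ℂ fun w => ?_
  have h0 : ⟪v, (dualLin Θ (star X * X) - dualLin Θ (star X) * C - star C * dualLin Θ X
      + star C * C) v⟫_ℂ = 0 := by rw [h, inner_zero_right]
  simp [ContinuousLinearMap.star_eq_adjoint, ContinuousLinearMap.adjoint_inner_right] at h0
  have := eq_zero_of_forall_nonneg
    (a := ⟪w, dualLin Θ (Y * X) v⟫_ℂ - ⟪w, dualLin Θ Y (C v)⟫_ℂ)
    (b := ⟪v, dualLin Θ (star X * star Y) w⟫_ℂ - ⟪C v, dualLin Θ (star Y) w⟫_ℂ)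
    (c := ⟪w, dualLin Θ (Y * star Y) w⟫_ℂ) fun t => by
      have := hΘ.dualLin_nonneg 3 ![X, 1, star Y] ![v, -C v, t • w]
      simp [Fin.sum_univ_three, hΘ.dualLin_one] at this
      refine this.trans_eq ?_
      simp [ContinuousLinearMap.star_eq_adjoint] at h0 ⊢
      linear_combination h0
  exact sub_eq_zero.mp this

theorem IsRankOneChannel.dualLin_mul_support {X : K →L[ℂ] K} {C ρ P : H →L[ℂ] H}
    (hP : IsSupport ρ P)
    (h : trace ((dualLin Θ (star X * X) - dualLin Θ (star X) * C - star C * dualLin Θ X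
      + star C * C) * ρ) = 0) (Y : K →L[ℂ] K) :
    dualLin Θ (Y * X) * P = dualLin Θ Y * C * P := by
  have h1 := hP.mul_eq_zero _
    (mul_eq_zero_of_trace_mul_eq_zero (hΘ.isPositive_defect X C) hP.isPositive h)
  ext x
  exact hΘ.dualLin_mul_apply congr($h1 x) Y

end Schwarz

/-! ### Fixed points under compression to the support of a fixed state -/

section FixedPoints

variable {H K : Type*} [NormedAddCommGroup H] [InnerProductSpace ℂ H] [FiniteDimensional ℂ H]
  [CompleteSpace H] [NormedAddCommGroup K] [InnerProductSpace ℂ K] [CompleteSpace K]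

/-- `A` is an operator on the range of `P` fixed by `A ↦ P Θ^*(j A) P`. -/
structure IsCompressedFixed (Θ : TraceClass H →ₗ[ℂ] TraceClass K)
    (j : (H →L[ℂ] H) →⋆ₐ[ℂ] (K →L[ℂ] K)) (P A : H →L[ℂ] H) : Prop where
  left : P * A = A
  right : A * P = A
  fixed : P * dualLin Θ (j A) * P = A

variable {Θ : TraceClass H →ₗ[ℂ] TraceClass K} (hΘ : IsRankOneChannel Θ)
  {j : (H →L[ℂ] H) →⋆ₐ[ℂ] (K →L[ℂ] K)} {ρ P : H →L[ℂ] H} (hP : IsSupport ρ P)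
  (hfix : ∀ A, trace (dualLin Θ (j A) * ρ) = trace (A * ρ))
include hΘ hP hfix

/-- With `X = j(1 - P)` and `C = 0` the defect is `Θ^*(j(1 - P))`, whose expectation in `ρ` is
`tr[(1 - P)ρ] = 0`. -/
theorem dualLin_mul_support_right (Y : K →L[ℂ] K) :
    dualLin Θ (Y * j P) * P = dualLin Θ Y * P := by
  have hQ := hP.isStarProjection.one_sub
  have h := hΘ.dualLin_mul_support (X := j (1 - P)) (C := 0) hP (by
    rw [← map_star, ← map_mul, hQ.isSelfAdjoint.star_eq, hQ.isIdempotentElem.eq]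
    simp only [mul_zero, star_zero, zero_mul, sub_zero, add_zero]
    rw [hfix, sub_mul, one_mul, hP.mul_eq, sub_self, ← traceLin_apply, map_zero]) Y
  rw [map_sub, map_one, mul_sub, mul_one, map_sub, sub_mul, mul_zero, zero_mul, sub_eq_zero] at h
  exact h.symm

theorem dualLin_mul_support_left (Y : K →L[ℂ] K) :
    P * dualLin Θ (j P * Y) = P * dualLin Θ Y := by
  have hs := hP.isStarProjection.isSelfAdjoint.star_eq
  have h := congr(star $(dualLin_mul_support_right hΘ hP hfix (star Y)))
  simpa only [star_mul, hs, ← hΘ.dualLin_star, star_star, ← map_star] using h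

theorem compress_dualLin (Y : K →L[ℂ] K) :
    P * dualLin Θ (j P * Y * j P) * P = P * dualLin Θ Y * P := by
  rw [mul_assoc (j P), dualLin_mul_support_left hΘ hP hfix, mul_assoc,
    dualLin_mul_support_right hΘ hP hfix, mul_assoc]

theorem compressedFixed_of_fixed {F : H →L[ℂ] H} (hF : dualLin Θ (j F) = F) :
    IsCompressedFixed Θ j P (P * F * P) := by
  have hi := hP.isStarProjection.isIdempotentElem.eq
  refine ⟨by rw [← mul_assoc, ← mul_assoc, hi], by rw [mul_assoc, hi], ?_⟩
  rw [map_mul j, map_mul j, compress_dualLin hΘ hP hfix, hF]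

omit hfix in
theorem IsCompressedFixed.star {A : H →L[ℂ] H} (hA : IsCompressedFixed Θ j P A) :
    IsCompressedFixed Θ j P (star A) := by
  have hs := hP.isStarProjection.isSelfAdjoint.star_eq
  refine ⟨?_, ?_, ?_⟩
  · simpa only [star_mul, hs] using congr(Star.star $(hA.right))
  · simpa only [star_mul, hs] using congr(Star.star $(hA.left))
  · simpa only [star_mul, hs, ← hΘ.dualLin_star, ← map_star, mul_assoc]
      using congr(Star.star $(hA.fixed))

/-- With `X = j A` and `C = A` all four terms of the defect have expectation `± tr[A^*A ρ]`: the
first by invariance of `ρ`, the cross terms by fixedness of `A`. -/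
theorem IsCompressedFixed.dualLin_mul_right {A : H →L[ℂ] H} (hA : IsCompressedFixed Θ j P A)
    (Y : K →L[ℂ] K) : dualLin Θ (Y * j A) * P = dualLin Θ Y * A := by
  have hA' := hA.star hΘ hP
  have h := hΘ.dualLin_mul_support (X := j A) (C := A) hP (by
    -- Fixedness concerns only `P Θ^*(j A) P`; the two copies of `P` are drawn from `A^* = A^* P`
    -- and `ρ = P ρ`. In `e2` cyclicity of the trace moves a `P` from `ρ = ρ P` to the front.
    have e1 : Star.star A * dualLin Θ (j A) * ρ = Star.star A * A * ρ := by
      nth_rw 1 [← hA'.right, ← hP.mul_eq]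
      nth_rw 4 [← hA.fixed]
      simp only [mul_assoc, hP.mul_eq]
    have e2 : trace (dualLin Θ (j (Star.star A)) * A * ρ) = trace (Star.star A * A * ρ) := by
      have : dualLin Θ (j (Star.star A)) * A * ρ
          = (dualLin Θ (j (Star.star A)) * (P * A * ρ)) * P := by
        rw [mul_assoc, mul_assoc, mul_assoc, mul_assoc, hP.mul_eq_right, ← mul_assoc P, hA.left]
      rw [this, ← trace_mul_comm (isTraceClass_of_finiteDimensional _)]
      nth_rw 2 [← hA'.fixed]
      simp only [mul_assoc]
    rw [← map_star, ← map_mul, add_mul, sub_mul, sub_mul]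
    simp only [← traceLin_apply, map_add, map_sub]
    simp only [traceLin_apply, hfix, e1, e2]
    ring) Y
  rw [h, mul_assoc, hA.right]

theorem IsCompressedFixed.dualLin_mul_left {A : H →L[ℂ] H} (hA : IsCompressedFixed Θ j P A)
    (Y : K →L[ℂ] K) : P * dualLin Θ (j A * Y) = A * dualLin Θ Y := by
  have hs := hP.isStarProjection.isSelfAdjoint.star_eq
  have h := congr(Star.star $((hA.star hΘ hP).dualLin_mul_right hΘ hP hfix (Star.star Y)))
  simpa only [star_mul, hs, ← hΘ.dualLin_star, star_star, ← map_star] using h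

theorem IsCompressedFixed.mul_compress {A : H →L[ℂ] H} (hA : IsCompressedFixed Θ j P A)
    (Y : K →L[ℂ] K) : A * (P * dualLin Θ Y * P) = P * dualLin Θ (j A * Y) * P := by
  rw [hA.dualLin_mul_left hΘ hP hfix, ← mul_assoc, ← mul_assoc, hA.right]

theorem IsCompressedFixed.compress_mul {A : H →L[ℂ] H} (hA : IsCompressedFixed Θ j P A)
    (Y : K →L[ℂ] K) : (P * dualLin Θ Y * P) * A = P * dualLin Θ (Y * j A) * P := by
  rw [mul_assoc P (dualLin Θ (Y * j A)), hA.dualLin_mul_right hΘ hP hfix, mul_assoc, hA.left,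
    mul_assoc]

theorem IsCompressedFixed.commute {A : H →L[ℂ] H} (hA : IsCompressedFixed Θ j P A)
    {Y : K →L[ℂ] K} (hY : Commute (j A) Y) : Commute A (P * dualLin Θ Y * P) := by
  rw [commute_iff_eq, hA.mul_compress hΘ hP hfix, hA.compress_mul hΘ hP hfix, hY.eq]

/-- If a fixed point `A = P Θ^*(Z) P`, with `Z` in the commutant of `j`, commutes with the increment
of `N`, then it commutes with `N`. -/
theorem IsCompressedFixed.commute_of_commute_increment {A N : H →L[ℂ] H} {Z : K →L[ℂ] K}
    (hA : IsCompressedFixed Θ j P A) (hAsa : IsSelfAdjoint A) (hNsa : IsSelfAdjoint N)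
    (hPN : P * N = N) (hNP : N * P = N)
    (hZ : ∀ B, Commute (j B) Z) (hAZ : A = P * dualLin Θ Z * P)
    (hΔ : Commute A (P * dualLin Θ (j N) * P - N)) : Commute A N := by
  refine commute_of_commute_commutator hAsa hNsa ?_
  -- The bimodule property gives `P Θ^*(j [A, N]) P = [A, P Θ^*(j N) P]`, which is `[A, N]` because
  -- `A` commutes with the increment.
  have hB : IsCompressedFixed Θ j P (A * N - N * A) := by
    refine ⟨?_, ?_, ?_⟩
    · rw [mul_sub, ← mul_assoc, ← mul_assoc, hA.left, hPN]
    · rw [sub_mul, mul_assoc, mul_assoc, hA.right, hNP]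
    · rw [map_sub j, map_mul j, map_mul j, map_sub, mul_sub, sub_mul, ← hA.mul_compress hΘ hP hfix,
        ← hA.compress_mul hΘ hP hfix]
      have := hΔ.eq
      rw [mul_sub, sub_mul] at this
      rw [sub_eq_iff_eq_add] at this
      rw [this]
      abel
  have := hB.commute hΘ hP hfix (hZ _)
  rw [← hAZ] at this
  exact this.symm

end FixedPoints

/-! ### Cesàro averages of linear maps with bounded orbits -/

section Cesaro

variable {E : Type*} [NormedAddCommGroup E] [NormedSpace ℂ E] {f : E →ₗ[ℂ] E}

/-- The averages `N⁻¹ ∑_{n=1}^N fⁿ x`. -/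
noncomputable def cesaro (f : E →ₗ[ℂ] E) (x : E) (N : ℕ) : E :=
  (N : ℂ)⁻¹ • ∑ n ∈ Finset.Icc 1 N, (f ^ n) x

theorem cesaro_of_fixed {x : E} (hx : f x = x) {N : ℕ} (hN : N ≠ 0) : cesaro f x N = x := by
  have h (n : ℕ) : (f ^ n) x = x := by
    induction n with
    | zero => simp
    | succ n ih => rw [pow_succ', Module.End.mul_apply, ih, hx]
  have hN' : (N : ℂ) ≠ 0 := Nat.cast_ne_zero.mpr hN
  simp only [cesaro, h, Finset.sum_const, Nat.card_Icc, Nat.add_sub_cancel]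
  rw [← Nat.cast_smul_eq_nsmul ℂ, smul_smul, inv_mul_cancel₀ hN', one_smul]

theorem sum_pow_sub (f : E →ₗ[ℂ] E) (z : E) (N : ℕ) :
    ∑ n ∈ Finset.Icc 1 N, (f ^ n) (f z - z) = (f ^ (N + 1)) z - f z := by
  induction N with
  | zero => simp
  | succ N ih =>
    rw [Finset.sum_Icc_succ_top (by omega), ih, map_sub, ← Module.End.mul_apply, ← pow_succ]
    abel

theorem tendsto_cesaro_sub {z : E} {C : ℝ} (hC : ∀ n : ℕ, ‖(f ^ n) z‖ ≤ C) :
    Filter.Tendsto (cesaro f (f z - z)) Filter.atTop (nhds 0) := by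
  refine squeeze_zero_norm (a := fun N : ℕ => (N : ℝ)⁻¹ * (C + C)) (fun N => ?_) ?_
  · rw [cesaro, sum_pow_sub, norm_smul, norm_inv, Complex.norm_natCast]
    gcongr
    exact (norm_sub_le _ _).trans (add_le_add (hC _) (by simpa using hC 1))
  · simpa using tendsto_inv_atTop_nhds_zero_nat.mul_const (C + C)

/-- If `y = f z - z` is fixed, then `fⁿ z = z + n y`, which is bounded only for `y = 0`. -/
theorem disjoint_ker_range_sub_one (hf : ∀ x, ∃ C : ℝ, ∀ n : ℕ, ‖(f ^ n) x‖ ≤ C) :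
    Disjoint (LinearMap.ker (f - 1)) (LinearMap.range (f - 1)) := by
  rw [Submodule.disjoint_def]
  rintro _ hy ⟨z, rfl⟩
  set y := (f - 1) z with hyz
  have hfy : f y = y := sub_eq_zero.mp (by simpa using hy)
  have hfz : f z = z + y := by simp [hyz]
  have hn (n : ℕ) : (f ^ n) z = z + (n : ℂ) • y := by
    induction n with
    | zero => simp
    | succ n ih =>
      rw [pow_succ', Module.End.mul_apply, ih, map_add, map_smul, hfy, hfz]
      push_cast
      module
  obtain ⟨C, hC⟩ := hf z
  by_contra hy0
  obtain ⟨n, hlt⟩ := exists_nat_gt ((C + ‖z‖) / ‖y‖)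
  rw [div_lt_iff₀ (norm_pos_iff.mpr hy0)] at hlt
  have h1 : ‖(n : ℂ) • y‖ ≤ ‖(f ^ n) z‖ + ‖z‖ := by
    rw [show (n : ℂ) • y = (f ^ n) z - z by rw [hn]; abel]
    exact norm_sub_le _ _
  rw [norm_smul, Complex.norm_natCast] at h1
  linarith [hC n]

/-- By disjointness and a dimension count the space splits into the kernel and the range of `f - 1`.
Averages are constant on the kernel and telescope to `0` on the range. -/
theorem exists_tendsto_cesaro [FiniteDimensional ℂ E]
    (hf : ∀ x, ∃ C : ℝ, ∀ n : ℕ, ‖(f ^ n) x‖ ≤ C) (x : E) :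
    ∃ y, f y = y ∧ Filter.Tendsto (cesaro f x) Filter.atTop (nhds y) := by
  have htop : LinearMap.ker (f - 1) ⊔ LinearMap.range (f - 1) = ⊤ := by
    refine Submodule.eq_top_of_disjoint _ _ ?_ (disjoint_ker_range_sub_one hf)
    rw [add_comm, LinearMap.finrank_range_add_finrank_ker]
  obtain ⟨a, ha, _, ⟨z, rfl⟩, rfl⟩ := Submodule.mem_sup.mp (htop ▸ Submodule.mem_top (x := x))
  have hfa : f a = a := sub_eq_zero.mp (by simpa using ha)
  refine ⟨a, hfa, ?_⟩
  obtain ⟨C, hC⟩ := hf z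
  have hlim := (tendsto_const_nhds (x := a)).add (tendsto_cesaro_sub hC)
  rw [add_zero] at hlim
  refine hlim.congr' ?_
  filter_upwards [Filter.eventually_ne_atTop 0] with N hN
  nth_rw 1 [← cesaro_of_fixed hfa hN]
  simp [cesaro, Finset.sum_add_distrib]

end Cesaro

/-! ### The averaged state -/

section Averaged

variable {H : Type*} [NormedAddCommGroup H] [InnerProductSpace ℂ H] [FiniteDimensional ℂ H]

omit [FiniteDimensional ℂ H] in
theorem exists_eq_sub_of_isPositive [CompleteSpace H] (A : H →L[ℂ] H) :
    ∃ T : Fin 4 → H →L[ℂ] H, (∀ i, (T i).IsPositive) ∧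
      A = T 0 - T 1 + Complex.I • T 2 - Complex.I • T 3 := by
  have hsa (B : H →L[ℂ] H) (hB : IsSelfAdjoint B) :
      ∃ S T : H →L[ℂ] H, S.IsPositive ∧ T.IsPositive ∧ B = S - T := by
    refine ⟨_, _, (ContinuousLinearMap.nonneg_iff_isPositive _).mp (CFC.posPart_nonneg B),
      (ContinuousLinearMap.nonneg_iff_isPositive _).mp (CFC.negPart_nonneg B),
      (CFC.posPart_sub_negPart B hB).symm⟩
  obtain ⟨S, T, hS, hT, hST⟩ := hsa (realPart A) (realPart A).2
  obtain ⟨S', T', hS', hT', hST'⟩ := hsa (imaginaryPart A) (imaginaryPart A).2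
  refine ⟨![S, T, S', T'], fun i => by fin_cases i <;> assumption, ?_⟩
  rw [← realPart_add_I_smul_imaginaryPart A, hST, hST', smul_sub]
  simp
  abel

variable [CompleteSpace H] {Φ : TraceClass H →ₗ[ℂ] TraceClass H} (hΦ : IsChannel Φ)

/-- A map on trace-class operators as a map on all operators. -/
noncomputable def onOperators (Φ : TraceClass H →ₗ[ℂ] TraceClass H) :
    (H →L[ℂ] H) →ₗ[ℂ] (H →L[ℂ] H) :=
  (TraceClass H).subtype ∘ₗ Φ ∘ₗ toTraceClass H

omit [CompleteSpace H] in
theorem onOperators_apply (A : H →L[ℂ] H) :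
    onOperators Φ A = (Φ (toTraceClass H A) : H →L[ℂ] H) := rfl

omit [CompleteSpace H] in
theorem onOperators_coe (T : TraceClass H) :
    onOperators Φ (T : H →L[ℂ] H) = (Φ T : H →L[ℂ] H) := rfl

omit [CompleteSpace H] in
theorem onOperators_pow_coe (n : ℕ) (T : TraceClass H) :
    (onOperators Φ ^ n) (T : H →L[ℂ] H) = ((Φ ^ n) T : H →L[ℂ] H) := by
  induction n with
  | zero => simp
  | succ n ih => rw [pow_succ', Module.End.mul_apply, ih, onOperators_coe, pow_succ',
      Module.End.mul_apply]

include hΦ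

theorem IsChannel.isPositive_map {A : H →L[ℂ] H} (hA : A.IsPositive) :
    (onOperators Φ A).IsPositive := by
  refine isPositive_of_inner_nonneg fun x => ?_
  have := hΦ.completelyPositive 1 (fun _ _ => toTraceClass H A)
    (fun v => by simpa using hA.inner_nonneg_right (v 0)) (fun _ => x)
  simpa [onOperators_apply] using this

theorem IsChannel.isPositive_pow {A : H →L[ℂ] H} (hA : A.IsPositive) (n : ℕ) :
    ((onOperators Φ ^ n) A).IsPositive := by
  induction n with
  | zero => simpa
  | succ n ih =>
    rw [pow_succ', Module.End.mul_apply]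
    exact hΦ.isPositive_map ih

theorem IsChannel.trace_pow (A : H →L[ℂ] H) (n : ℕ) :
    trace ((onOperators Φ ^ n) A) = trace A := by
  induction n with
  | zero => simp
  | succ n ih =>
    rw [pow_succ', Module.End.mul_apply, onOperators_apply, hΦ.trace_eq, coe_toTraceClass, ih]

/-- On positive operators the norm is at most the trace, which is constant along the orbit; a
general operator is a combination of four positive ones. -/
theorem IsChannel.exists_norm_pow_le (A : H →L[ℂ] H) :
    ∃ C : ℝ, ∀ n : ℕ, ‖(onOperators Φ ^ n) A‖ ≤ C := by
  obtain ⟨T, hT, rfl⟩ := exists_eq_sub_of_isPositive A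
  have h (i) (n : ℕ) : ‖(onOperators Φ ^ n) (T i)‖ ≤ (trace (T i)).re := by
    have := norm_le_re_trace (hΦ.isPositive_pow (hT i) n)
    rwa [hΦ.trace_pow] at this
  refine ⟨(trace (T 0)).re + (trace (T 1)).re + (trace (T 2)).re + (trace (T 3)).re, fun n => ?_⟩
  simp only [map_add, map_sub, map_smul]
  refine (norm_sub_le _ _).trans (add_le_add ((norm_add_le _ _).trans (add_le_add
    ((norm_sub_le _ _).trans (add_le_add (h 0 n) (h 1 n))) ?_)) ?_)
  · simpa [norm_smul] using h 2 n
  · simpa [norm_smul] using h 3 n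

omit hΦ [FiniteDimensional ℂ H] [CompleteSpace H] in
theorem isPositive_of_tendsto {A : ℕ → H →L[ℂ] H} {B : H →L[ℂ] H}
    (h : Filter.Tendsto A Filter.atTop (nhds B)) (hA : ∀ᶠ n in Filter.atTop, (A n).IsPositive) :
    B.IsPositive := by
  refine isPositive_of_inner_nonneg fun x => ?_
  have hx : Filter.Tendsto (fun n => ⟪x, A n x⟫_ℂ) Filter.atTop (nhds ⟪x, B x⟫_ℂ) :=
    tendsto_const_nhds.inner ((ContinuousLinearMap.apply ℂ H x).continuous.tendsto B |>.comp h)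
  refine ge_of_tendsto hx ?_
  filter_upwards [hA] with n hn using hn.inner_nonneg_right x

theorem IsChannel.isPositive_cesaro {A : H →L[ℂ] H} (hA : A.IsPositive) (N : ℕ) :
    (cesaro (onOperators Φ) A N).IsPositive := by
  refine (ContinuousLinearMap.isPositive_sum _ fun n _ => hΦ.isPositive_pow hA n).smul_of_nonneg ?_
  rw [inv_nonneg]
  exact Nat.cast_nonneg N

theorem IsChannel.trace_cesaro (A : H →L[ℂ] H) {N : ℕ} (hN : N ≠ 0) :
    trace (cesaro (onOperators Φ) A N) = trace A := by
  have hN' : (N : ℂ) ≠ 0 := Nat.cast_ne_zero.mpr hN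
  rw [cesaro, ← traceLin_apply, map_smul, map_sum]
  simp [hΦ.trace_pow, hN']

omit hΦ [CompleteSpace H] in
theorem coe_maximallyMixed :
    (maximallyMixed H : H →L[ℂ] H) = (Module.finrank ℂ H : ℂ)⁻¹ • 1 := rfl

omit hΦ in
theorem trace_maximallyMixed [Nontrivial H] : trace (maximallyMixed H : H →L[ℂ] H) = 1 := by
  let b := stdOrthonormalBasis ℂ H
  have h1 : (1 : H →L[ℂ] H) = 1 * ∑ i, rankOne ℂ (b i) (b i) := by
    rw [b.sum_rankOne_eq_id]
    rfl
  have h2 : (Module.finrank ℂ H : ℂ) ≠ 0 := Nat.cast_ne_zero.mpr Module.finrank_pos.ne'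
  rw [coe_maximallyMixed, trace_smul _ (isTraceClass_of_finiteDimensional _), h1, trace_sum_rankOne]
  simp [h2]

omit hΦ in
theorem exists_smul_maximallyMixed_sub_isPositive [Nontrivial H] {ρ : H →L[ℂ] H}
    (hρ : ρ.IsPositive) :
    ∃ c : ℂ, (c • (maximallyMixed H : H →L[ℂ] H) - ρ).IsPositive := by
  have h2 : (Module.finrank ℂ H : ℂ) ≠ 0 := Nat.cast_ne_zero.mpr Module.finrank_pos.ne'
  refine ⟨(‖ρ‖ : ℂ) * Module.finrank ℂ H, ?_⟩
  rw [coe_maximallyMixed, smul_smul, mul_assoc, mul_inv_cancel₀ h2, mul_one]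
  have := hρ.isSelfAdjoint.le_algebraMap_norm_self
  rw [ContinuousLinearMap.le_def] at this
  convert this using 2
  ext
  simp [Algebra.algebraMap_eq_smul_one]

/-- A fixed state is dominated by a multiple of `d⁻¹ 1`; averaging keeps the order and fixes the
state, so it is dominated by the same multiple of `ρ₀`. Minimality holds because `ρ₀` is a fixed
state itself. -/
theorem IsChannel.exists_averagedState : ∃ ρ₀ P : H →L[ℂ] H,
    Filter.Tendsto (cesaro (onOperators Φ) (maximallyMixed H : H →L[ℂ] H)) Filter.atTop (nhds ρ₀) ∧
    onOperators Φ ρ₀ = ρ₀ ∧ IsSupport ρ₀ P ∧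
    IsLeast {Q : H →L[ℂ] H | IsStarProjection Q ∧
      ∀ ρ : TraceClass H, IsState ρ → Φ ρ = ρ →
        (ρ : H →L[ℂ] H) = Q * (ρ : H →L[ℂ] H) * Q} P := by
  obtain ⟨ρ₀, hfix, hlim⟩ := exists_tendsto_cesaro hΦ.exists_norm_pow_le
    (maximallyMixed H : H →L[ℂ] H)
  have hmm : (maximallyMixed H : H →L[ℂ] H).IsPositive := by
    rw [coe_maximallyMixed]
    refine ContinuousLinearMap.isPositive_one.smul_of_nonneg ?_
    rw [inv_nonneg]
    exact Nat.cast_nonneg _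
  have hρ₀ : ρ₀.IsPositive :=
    isPositive_of_tendsto hlim (Filter.Eventually.of_forall (hΦ.isPositive_cesaro hmm))
  obtain ⟨P, hP⟩ := exists_isSupport hρ₀
  refine ⟨ρ₀, P, hlim, hfix, hP, ?_⟩
  -- On the zero space `d⁻¹ 1` has trace `0` and is not a state.
  rcases subsingleton_or_nontrivial H with hH | hH
  · exact ⟨⟨hP.isStarProjection, fun _ _ _ => Subsingleton.elim _ _⟩,
      fun Q _ => (Subsingleton.elim P Q).le⟩
  refine ⟨⟨hP.isStarProjection, fun ρ hρ hρfix => ?_⟩, fun Q ⟨hQ, hQfix⟩ => ?_⟩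
  · obtain ⟨c, hc⟩ := exists_smul_maximallyMixed_sub_isPositive hρ.1
    refine mul_mul_eq_of_le hP hρ.1 c ?_
    refine isPositive_of_tendsto ((hlim.const_smul c).sub_const _) ?_
    filter_upwards [Filter.eventually_ne_atTop 0] with N hN
    have h1 : onOperators Φ (ρ : H →L[ℂ] H) = ρ := by rw [onOperators_coe, hρfix]
    have h2 := hΦ.isPositive_cesaro hc N
    have h3 : cesaro (onOperators Φ) (c • (maximallyMixed H : H →L[ℂ] H) - (ρ : H →L[ℂ] H)) N =
        c • cesaro (onOperators Φ) (maximallyMixed H : H →L[ℂ] H) N -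
          cesaro (onOperators Φ) (ρ : H →L[ℂ] H) N := by
      simp only [cesaro, map_sub, map_smul, Finset.sum_sub_distrib, ← Finset.smul_sum, smul_sub]
      rw [smul_comm]
    rwa [h3, cesaro_of_fixed h1 hN] at h2
  · have htr : trace ρ₀ = 1 := by
      have hcont : Continuous (traceLin H) := (traceLin H).continuous_of_finiteDimensional
      have h1 := (hcont.tendsto ρ₀).comp hlim
      rw [traceLin_apply] at h1
      refine tendsto_nhds_unique h1 (tendsto_const_nhds.congr' ?_)
      filter_upwards [Filter.eventually_ne_atTop 0] with N hN
      rw [Function.comp_apply, traceLin_apply, hΦ.trace_cesaro _ hN, trace_maximallyMixed]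
    exact hP.isMinSupportProjection.2
      ⟨hQ, hQfix (toTraceClass H ρ₀) ⟨hρ₀, htr⟩ (Subtype.ext hfix)⟩

end Averaged

/-! ### Traces of tensor products -/

section Tensor

variable {HS HA : Type*} [NormedAddCommGroup HS] [InnerProductSpace ℂ HS]
  [FiniteDimensional ℂ HS] [NormedAddCommGroup HA] [InnerProductSpace ℂ HA]

/-- `⟨a| ⊗ 1`. -/
noncomputable def braTensor (HA : Type*) [NormedAddCommGroup HA] [InnerProductSpace ℂ HA] (a : HS) :
    HS ⊗[ℂ] HA →ₗ[ℂ] HA :=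
  TensorProduct.lid ℂ HA ∘ₗ
    LinearMap.rTensor HA ((innerSL ℂ a : HS →L[ℂ] ℂ) : HS →ₗ[ℂ] ℂ)

omit [FiniteDimensional ℂ HS] in
@[simp] theorem braTensor_tmul (a x : HS) (y : HA) :
    braTensor HA a (x ⊗ₜ[ℂ] y) = ⟪a, x⟫_ℂ • y := by
  simp [braTensor]

omit [FiniteDimensional ℂ HS] in
theorem inner_mapL_rankOne (a b : HS) (S : HA →L[ℂ] HA) (w z : HS ⊗[ℂ] HA) :
    ⟪w, TensorProduct.mapL (rankOne ℂ a b) S z⟫_ℂ =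
      ⟪braTensor HA a w, S (braTensor HA b z)⟫_ℂ := by
  induction z using TensorProduct.induction_on with
  | zero => simp
  | add z z' h h' => simp only [map_add, inner_add_right, h, h']
  | tmul x y =>
    induction w using TensorProduct.induction_on with
    | zero => simp
    | add w w' h h' => simp only [map_add, inner_add_left, h, h']
    | tmul x' y' =>
      rw [TensorProduct.mapL_tmul]
      simp [TensorProduct.inner_tmul, inner_smul_right]
      ring

/-- `A ↦ A ⊗ 1`. -/
noncomputable def tensorOne (HS HA : Type*) [NormedAddCommGroup HS] [InnerProductSpace ℂ HS]
    [CompleteSpace HS] [FiniteDimensional ℂ HS] [NormedAddCommGroup HA] [InnerProductSpace ℂ HA]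
    [CompleteSpace HA] :
    (HS →L[ℂ] HS) →⋆ₐ[ℂ] ((HS ⊗[ℂ] HA) →L[ℂ] (HS ⊗[ℂ] HA)) where
  toFun A := TensorProduct.mapL A 1
  map_one' := TensorProduct.mapL_id_id
  map_mul' A B := by rw [← TensorProduct.mapL_mul, one_mul]
  map_zero' := by simp
  map_add' A B := TensorProduct.mapL_add_left A B 1
  commutes' c := by
    rw [Algebra.algebraMap_eq_smul_one, Algebra.algebraMap_eq_smul_one,
      TensorProduct.mapL_smul_left]
    exact congrArg (c • ·) TensorProduct.mapL_id_id
  map_star' A := by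
    rw [ContinuousLinearMap.star_eq_adjoint, ContinuousLinearMap.star_eq_adjoint,
      TensorProduct.adjoint_mapL, ← ContinuousLinearMap.star_eq_adjoint 1, star_one]

variable [CompleteSpace HS] [CompleteSpace HA]

theorem tensorOne_apply (A : HS →L[ℂ] HS) : tensorOne HS HA A = TensorProduct.mapL A 1 := rfl

theorem mapL_eq_tensorOne_mul (A : HS →L[ℂ] HS) (B : HA →L[ℂ] HA) :
    TensorProduct.mapL A B = tensorOne HS HA A * TensorProduct.mapL 1 B := by
  rw [tensorOne_apply, ← TensorProduct.mapL_mul, mul_one, one_mul]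

theorem commute_tensorOne (A : HS →L[ℂ] HS) (B : HA →L[ℂ] HA) :
    Commute (tensorOne HS HA A) (TensorProduct.mapL 1 B) := by
  rw [commute_iff_eq, tensorOne_apply, ← TensorProduct.mapL_mul, ← TensorProduct.mapL_mul]
  simp only [mul_one, one_mul]

/-- `T ↦ T ⊗ S` as a linear map. -/
noncomputable def tensorRight (HS : Type*) [NormedAddCommGroup HS] [InnerProductSpace ℂ HS]
    [FiniteDimensional ℂ HS] (S : TraceClass HA) :
    TraceClass HS →ₗ[ℂ] TraceClass (HS ⊗[ℂ] HA) where
  toFun T := TraceClass.tensor T S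
  map_add' _ _ := Subtype.ext (TensorProduct.mapL_add_left _ _ _)
  map_smul' _ _ := Subtype.ext (TensorProduct.mapL_smul_left _ _ _)

omit [CompleteSpace HS] in
theorem coe_tensorRight (S : TraceClass HA) (T : TraceClass HS) :
    (tensorRight HS S T : HS ⊗[ℂ] HA →L[ℂ] HS ⊗[ℂ] HA) =
      TensorProduct.mapL (T : HS →L[ℂ] HS) (S : HA →L[ℂ] HA) := rfl

omit [CompleteSpace HS] in
theorem trace_mapL_rankOne (a b : HS) (S : TraceClass HA) :
    trace (TensorProduct.mapL (rankOne ℂ a b) (S : HA →L[ℂ] HA)) =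
      ⟪b, a⟫_ℂ * trace (S : HA →L[ℂ] HA) := by
  obtain ⟨u, v, hs, h⟩ := S.2
  have h1 := hasSum_trace (T := TensorProduct.mapL (rankOne ℂ a b) (S : HA →L[ℂ] HA))
    (u := fun n => a ⊗ₜ[ℂ] u n) (v := fun n => b ⊗ₜ[ℂ] v n)
    ((hs.mul_left (‖a‖ * ‖b‖)).congr fun n => by simp only [TensorProduct.norm_tmul]; ring)
    (fun z => by
      induction z using TensorProduct.induction_on with
      | zero => simp
      | add z z' h h' => simpa [inner_add_right, add_smul] using h.add h'
      | tmul x y =>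
        have := (TensorProduct.mkL ℂ HS HA (⟪b, x⟫_ℂ • a)).hasSum (h y)
        simpa [TensorProduct.tmul_smul, ← TensorProduct.smul_tmul', smul_smul, mul_comm]
          using this)
  have h2 := (hasSum_trace hs h).mul_left ⟪b, a⟫_ℂ
  exact h1.unique (by simpa using h2)

theorem trace_mapL (T : HS →L[ℂ] HS) (S : TraceClass HA) :
    trace (TensorProduct.mapL T (S : HA →L[ℂ] HA)) = trace T * trace (S : HA →L[ℂ] HA) := by
  -- The functional `T ↦ tr[T ⊗ S]` is represented by some `B`, and rank-one `T` identify `B` as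
  -- `tr[S] 1`.
  obtain ⟨B, hB⟩ := exists_trace_mul_eq
    (traceMul (HS ⊗[ℂ] HA) 1 ∘ₗ tensorRight HS S ∘ₗ toTraceClass HS)
  simp only [LinearMap.comp_apply, traceMul_apply, one_mul, coe_tensorRight,
    coe_toTraceClass] at hB
  have hB1 : B = trace (S : HA →L[ℂ] HA) • (1 : HS →L[ℂ] HS) := by
    ext x
    refine ext_inner_left ℂ fun y => ?_
    rw [← trace_mul_rankOne, hB, trace_mapL_rankOne]
    simp [inner_smul_right, mul_comm]
  rw [← hB, hB1, smul_mul_assoc, one_mul, trace_smul _ (isTraceClass_of_finiteDimensional _),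
    mul_comm]

end Tensor

/-! ### The joint dual of a measurement scheme -/

section Scheme

variable {X HS HA : Type*} [Countable X]
  [NormedAddCommGroup HS] [InnerProductSpace ℂ HS] [CompleteSpace HS] [FiniteDimensional ℂ HS]
  [NormedAddCommGroup HA] [InnerProductSpace ℂ HA] [CompleteSpace HA]

/-- `T ↦ 𝓔(T ⊗ ξ)`. -/
noncomputable def MeasurementScheme.jointMap (M : MeasurementScheme X HS HA) :
    TraceClass HS →ₗ[ℂ] TraceClass (HS ⊗[ℂ] HA) :=
  M.interaction ∘ₗ tensorRight HS M.ξ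

theorem MeasurementScheme.isRankOneChannel_jointMap (M : MeasurementScheme X HS HA) :
    IsRankOneChannel M.jointMap where
  nonneg n v w := by
    refine M.isChannel.completelyPositive n
      (fun i j => tensorRight HS M.ξ (toTraceClass HS (rankOne ℂ (v i) (v j)))) (fun z => ?_) w
    simp only [coe_tensorRight, coe_toTraceClass, inner_mapL_rankOne]
    -- The block form of `|vᵢ⟩⟨vⱼ| ⊗ ξ` collapses to `⟨η, ξ η⟩` with `η = ∑ⱼ (⟨vⱼ| ⊗ 1) zⱼ`.
    rw [Finset.sum_congr rfl fun i _ => (by rw [← inner_sum, ← map_sum] :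
      _ = ⟪braTensor HA (v i) (z i), (M.ξ : HA →L[ℂ] HA) (∑ j, braTensor HA (v j) (z j))⟫_ℂ),
      ← sum_inner]
    exact M.isState.1.inner_nonneg_right _
  trace_eq T := by
    rw [MeasurementScheme.jointMap, LinearMap.comp_apply, M.isChannel.trace_eq, coe_tensorRight,
      trace_mapL, M.isState.2, mul_one]

theorem Observable.norm_sum_effect_le (Z : Observable X HA) (s : Finset X) :
    ‖∑ x ∈ s, Z.effect x‖ ≤ 1 := by
  have h0 : (∑ x ∈ s, Z.effect x).IsPositive :=
    ContinuousLinearMap.isPositive_sum s fun x _ => Z.isPositive x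
  rw [CStarAlgebra.norm_le_one_iff_of_nonneg _
    ((ContinuousLinearMap.nonneg_iff_isPositive _).mpr h0), ContinuousLinearMap.le_def]
  refine isPositive_of_inner_nonneg fun v => ?_
  have h := (Z.hasSum_effect v).mapL (innerSL ℂ v)
  have := sum_le_hasSum s (fun x _ => (Z.isPositive x).inner_nonneg_right v) h
  simpa [inner_sub_right, inner_sum] using this

omit [FiniteDimensional ℂ HS] [CompleteSpace HS] in
theorem Observable.hasSum_mapL_effect (Z : Observable X HA) (A : HS →L[ℂ] HS)
    (z : HS ⊗[ℂ] HA) :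
    HasSum (fun x => TensorProduct.mapL A (Z.effect x) z) (TensorProduct.mapL A 1 z) := by
  induction z using TensorProduct.induction_on with
  | zero => simp
  | add z z' h h' => simpa using h.add h'
  | tmul a y => simpa using (TensorProduct.mkL ℂ HS HA (A a)).hasSum (Z.hasSum_effect y)

omit [CompleteSpace HS] in
theorem Observable.hasSum_trace_mapL_effect (Z : Observable X HA) (A : HS →L[ℂ] HS)
    (W : TraceClass (HS ⊗[ℂ] HA)) :
    HasSum (fun x => trace (TensorProduct.mapL A (Z.effect x) *
        (W : HS ⊗[ℂ] HA →L[ℂ] HS ⊗[ℂ] HA)))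
      (trace (TensorProduct.mapL A 1 * (W : HS ⊗[ℂ] HA →L[ℂ] HS ⊗[ℂ] HA))) := by
  have h := tendsto_trace_mul (l := Filter.atTop)
    (B := fun s : Finset X => ∑ x ∈ s, TensorProduct.mapL A (Z.effect x))
    (B₀ := TensorProduct.mapL A 1) (C := ‖A‖) (fun s => ?_) (fun z => ?_) W
  · refine h.congr fun s => ?_
    simp only [← traceMul_apply, map_sum, LinearMap.sum_apply]
  · have : ∑ x ∈ s, TensorProduct.mapL A (Z.effect x) =
        TensorProduct.mapL A (∑ x ∈ s, Z.effect x) := by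
      induction s using Finset.cons_induction with
      | empty => simp
      | cons x s hx ih =>
        rw [Finset.sum_cons, Finset.sum_cons, ih, TensorProduct.mapL_add_right]
    rw [this]
    refine (TensorProduct.norm_mapL_le _ _).trans ?_
    exact mul_le_of_le_one_right (norm_nonneg _) (Z.norm_sum_effect_le s)
  · refine Filter.Tendsto.congr (fun s => ?_) (Z.hasSum_mapL_effect A z)
    rw [sum_apply]

theorem Instrument.hasSum_trace_mul_op (I : Instrument X HS) (A : HS →L[ℂ] HS)
    (T : TraceClass HS) :
    HasSum (fun x => trace (A * (I.op x T : HS →L[ℂ] HS)))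
      (trace (A * (I.total T : HS →L[ℂ] HS))) := by
  let f : (HS →L[ℂ] HS) →ₗ[ℂ] ℂ := traceLin HS ∘ₗ LinearMap.mulLeft ℂ A
  have := (I.hasSum_op T).map f f.continuous_of_finiteDimensional
  simpa [f, Function.comp_def] using this

variable {M : MeasurementScheme X HS HA} {I : Instrument X HS} (hM : M.Implements I)
include hM

theorem MeasurementScheme.Implements.trace_mapL_effect (x : X) (A : HS →L[ℂ] HS)
    (T : TraceClass HS) :
    trace (TensorProduct.mapL A (M.pointer.effect x) *
        (M.jointMap T : HS ⊗[ℂ] HA →L[ℂ] HS ⊗[ℂ] HA)) =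
      trace (A * (I.op x T : HS →L[ℂ] HS)) := by
  rw [hM x T A, mapL_eq_tensorOne_mul, mul_assoc]
  rfl

theorem MeasurementScheme.Implements.dualLin_mapL_effect (x : X) (A : HS →L[ℂ] HS) :
    dualLin M.jointMap (TensorProduct.mapL A (M.pointer.effect x)) = dual (I.op x) A :=
  eq_dual_iff.mpr fun T => by
    rw [dualLin_apply, trace_dual_mul, hM.trace_mapL_effect]

/-- Sum the identity for single outcomes over `x`: the pointer effects add up to `1`, the operations
to the total channel. -/
theorem MeasurementScheme.Implements.dualLin_tensorOne (A : HS →L[ℂ] HS) :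
    dualLin M.jointMap (tensorOne HS HA A) = dual I.total A :=
  eq_dual_iff.mpr fun T => by
    rw [dualLin_apply, trace_dual_mul, tensorOne_apply]
    refine (M.pointer.hasSum_trace_mapL_effect A (M.jointMap T)).unique ?_
    simp only [hM.trace_mapL_effect]
    exact I.hasSum_trace_mul_op A T

omit hM

omit [FiniteDimensional ℂ HS] [CompleteSpace HS] [CompleteSpace HA] in
theorem additive_mul_mapL (NS T : HS →L[ℂ] HS) (NA S : HA →L[ℂ] HA) :
    additive NS NA * TensorProduct.mapL T S =
      TensorProduct.mapL (NS * T) S + TensorProduct.mapL T (NA * S) := by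
  rw [additive, add_mul, ← TensorProduct.mapL_mul, ← TensorProduct.mapL_mul, one_mul, one_mul]

omit [CompleteSpace HS] in
theorem isState_tensor_rankOne {ξ : TraceClass HA} (hξ : IsState ξ) {a : HS} (ha : ‖a‖ = 1) :
    IsState (tensorRight HS ξ (toTraceClass HS (rankOne ℂ a a))) := by
  refine ⟨isPositive_of_inner_nonneg fun z => ?_, ?_⟩
  · rw [coe_tensorRight, coe_toTraceClass, inner_mapL_rankOne]
    exact hξ.1.inner_nonneg_right _
  · rw [coe_tensorRight, coe_toTraceClass, trace_mapL_rankOne, hξ.2, mul_one,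
      inner_self_eq_norm_sq_to_K, ha]
    simp

omit [CompleteSpace HS] [FiniteDimensional ℂ HS] in
theorem eq_of_inner_self_eq {A B : HS →L[ℂ] HS}
    (h : ∀ a : HS, ‖a‖ = 1 → ⟪a, A a⟫_ℂ = ⟪a, B a⟫_ℂ) : A = B := by
  have h0 : ((A - B : HS →L[ℂ] HS) : HS →ₗ[ℂ] HS) = 0 := by
    rw [← inner_map_self_eq_zero]
    intro x
    by_cases hx : x = 0
    · simp [hx]
    have hn : (‖x‖ : ℂ) ≠ 0 := by simpa using hx
    have h1 := h ((‖x‖ : ℂ)⁻¹ • x) (by simp [norm_smul, hx])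
    simp only [map_smul, inner_smul_left, inner_smul_right] at h1
    have h2 := mul_left_cancel₀ ((map_ne_zero (starRingEnd ℂ)).mpr (inv_ne_zero hn))
      (mul_left_cancel₀ (inv_ne_zero hn) h1)
    rw [← inner_conj_symm]
    simp [inner_sub_right, h2]
  exact sub_eq_zero.mp (ContinuousLinearMap.coe_injective h0)

/-- Conservation is tested on the states `|a⟩⟨a| ⊗ ξ`; the resulting quadratic form in `a`
determines the operator. -/
theorem dualLin_additive {NS : HS →L[ℂ] HS} {NA : HA →L[ℂ] HA}
    (hN : ConservesOnAverage M.interaction (additive NS NA)) :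
    dualLin M.jointMap (additive NS NA) =
      NS + trace (NA * (M.ξ : HA →L[ℂ] HA)) • (1 : HS →L[ℂ] HS) := by
  refine eq_of_inner_self_eq fun a ha => ?_
  have h := hN _ (isState_tensor_rankOne M.isState ha)
  rw [inner_dualLin, MeasurementScheme.jointMap, LinearMap.comp_apply, h, coe_tensorRight,
    coe_toTraceClass, additive_mul_mapL,
    trace_add (IsTraceClass.tensor (isTraceClass_of_finiteDimensional _) M.ξ.2)
      (IsTraceClass.tensor (isTraceClass_of_finiteDimensional _) (M.ξ.2.mul_left NA)),
    trace_mapL, trace_mul_rankOne, M.isState.2]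
  have := trace_mapL_rankOne a a ⟨_, M.ξ.2.mul_left NA⟩
  rw [this]
  simp [mul_comm]

end Scheme

/-! ### Repeatable instruments are of the first kind -/

section Repeatable

variable {X HS : Type*} [Countable X]
  [NormedAddCommGroup HS] [InnerProductSpace ℂ HS] [CompleteSpace HS] [FiniteDimensional ℂ HS]

theorem isState_rankOne {a : HS} (ha : ‖a‖ = 1) : IsState (toTraceClass HS (rankOne ℂ a a)) := by
  refine ⟨InnerProductSpace.isPositive_rankOne_self a, ?_⟩
  rw [coe_toTraceClass, trace_rankOne, inner_self_eq_norm_sq_to_K, ha]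
  simp

variable {E : Observable X HS} {I : Instrument X HS} (hE : I.IsCompatible E)
include hE

theorem Instrument.IsCompatible.trace_effect_mul (x : X) (T : TraceClass HS) :
    trace (E.effect x * (T : HS →L[ℂ] HS)) = trace (I.op x T : HS →L[ℂ] HS) := by
  rw [← hE x, trace_dual_mul, one_mul]

open Classical in
theorem Instrument.IsRepeatable.dual_effect (hR : I.IsRepeatable) (x y : X) :
    dual (I.op x) (E.effect y) = if x = y then E.effect x else 0 := by
  refine eq_of_inner_self_eq fun a ha => ?_
  have h := hR _ (isState_rankOne ha) x y
  rw [← dualLin_apply, inner_dualLin, hE.trace_effect_mul, h, ← hE.trace_effect_mul,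
    coe_toTraceClass, trace_mul_rankOne]
  split_ifs <;> simp

theorem Instrument.IsRepeatable.isFirstKind (hR : I.IsRepeatable) : I.IsFirstKind E := by
  classical
  intro y
  refine (eq_dual_iff.mpr fun T => ?_).symm
  refine HasSum.unique ?_ (I.hasSum_trace_mul_op (E.effect y) T)
  simp only [← trace_dual_mul, hR.dual_effect hE]
  convert hasSum_single (f := fun x => trace ((if x = y then E.effect x else 0) *
    (T : HS →L[ℂ] HS))) y fun x hx => ?_ using 1
  · simp
  · simp [hx, ← traceLin_apply]

end Repeatable

end WAY

/-! ### The theorem on measurement, disturbance and conservation -/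

theorem mainTheorem8
    {HS HA X Y : Type*} [Countable X] [Countable Y]
    [NormedAddCommGroup HS] [InnerProductSpace ℂ HS] [CompleteSpace HS] [FiniteDimensional ℂ HS]
    [NormedAddCommGroup HA] [InnerProductSpace ℂ HA] [CompleteSpace HA]
    [TopologicalSpace.SeparableSpace HA]
    (E : WAY.Observable X HS) (I : WAY.Instrument X HS) (hE : I.IsCompatible E)
    (M : WAY.MeasurementScheme X HS HA) (hM : M.Implements I)
    (NS : HS →L[ℂ] HS) (hNS : IsSelfAdjoint NS) (NA : HA →L[ℂ] HA) (hNA : IsSelfAdjoint NA)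
    (hN : WAY.ConservesOnAverage M.interaction (WAY.additive NS NA)) :
    ∃ ρ₀ P : HS →L[ℂ] HS,
      I.IsAveragedState ρ₀ ∧ WAY.IsMinSupportProjection ρ₀ P ∧ I.IsMinFixedSupport P ∧
      (∀ F : WAY.Observable Y HS, I.NotDisturbs F →
        (∀ x y, Commute (F.compress P y) (E.compress P x)) ∧
        (∀ y, Commute (F.compress P y) (I.delta P NS)) ∧
        ((∀ y, Commute (F.compress P y) (P * NS * P)) →
          ∀ y, Commute (F.compress P y) (I.delta P NS))) ∧
      (I.IsFirstKind E →
        (∀ x y, Commute (E.compress P x) (E.compress P y)) ∧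
        (∀ x, Commute (E.compress P x) (P * NS * P))) ∧
      (I.IsRepeatable →
        WAY.IsSharp (E.compress P) ∧
        (∀ x, Commute (E.compress P x) (P * NS * P))) := by
  obtain ⟨ρ₀, P, hlim, hρfix, hP, hmin⟩ := I.isChannel.exists_averagedState
  have hΘ := M.isRankOneChannel_jointMap
  have hidem : P * P = P := hP.isStarProjection.isIdempotentElem.eq
  have hPsa : IsSelfAdjoint P := hP.isStarProjection.isSelfAdjoint
  have hfix (A : HS →L[ℂ] HS) :
      WAY.trace (WAY.dualLin M.jointMap (WAY.tensorOne HS HA A) * ρ₀) = WAY.trace (A * ρ₀) := by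
    rw [hM.dualLin_tensorOne]
    exact (WAY.trace_dual_mul I.total A (WAY.toTraceClass HS ρ₀)).trans (by
      rw [← WAY.onOperators_apply, hρfix])
  have hEΨ (x : X) :
      WAY.dualLin M.jointMap (TensorProduct.mapL 1 (M.pointer.effect x)) = E.effect x := by
    rw [hM.dualLin_mapL_effect, hE x]
  have hEc (x : X) : E.compress P x =
      P * WAY.dualLin M.jointMap (TensorProduct.mapL 1 (M.pointer.effect x)) * P := by
    rw [hEΨ, WAY.Observable.compress]
  have hcomm {A : HS →L[ℂ] HS}
      (hA : WAY.IsCompressedFixed M.jointMap (WAY.tensorOne HS HA) P A) (B : HA →L[ℂ] HA) :=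
    hA.commute hΘ hP hfix (WAY.commute_tensorOne A B)
  have hcompressed : P * WAY.dualLin M.jointMap (WAY.tensorOne HS HA (P * NS * P)) * P =
      P * WAY.dualLin M.jointMap (WAY.tensorOne HS HA NS) * P := by
    rw [map_mul (WAY.tensorOne HS HA), map_mul (WAY.tensorOne HS HA),
      WAY.compress_dualLin hΘ hP hfix]
  have hdelta : I.delta P NS =
      P * WAY.dualLin M.jointMap (WAY.tensorOne HS HA (P * NS * P)) * P - P * NS * P := by
    rw [hM.dualLin_tensorOne, WAY.Instrument.delta, WAY.Instrument.compressedDual]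
  -- Conservation rewrites the increment through the apparatus operator `1 ⊗ N_A`, which commutes
  -- with every `A ⊗ 1`.
  have hbalance : I.delta P NS = WAY.trace (NA * (M.ξ : HA →L[ℂ] HA)) • P -
      P * WAY.dualLin M.jointMap (TensorProduct.mapL 1 NA) * P := by
    have h := WAY.dualLin_additive hN
    rw [WAY.additive, map_add, ← WAY.tensorOne_apply, ← eq_sub_iff_add_eq] at h
    rw [hdelta, hcompressed, h]
    simp only [mul_sub, sub_mul, mul_add, add_mul, mul_smul_comm, smul_mul_assoc, mul_one, hidem]
    abel
  have hcommDelta {A : HS →L[ℂ] HS}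
      (hA : WAY.IsCompressedFixed M.jointMap (WAY.tensorOne HS HA) P A) :
      Commute A (I.delta P NS) := by
    rw [hbalance]
    refine Commute.sub_right (Commute.smul_right ?_ _) (hcomm hA NA)
    rw [commute_iff_eq, hA.left, hA.right]
  have hfixed {F : HS →L[ℂ] HS} (hF : WAY.dual I.total F = F) :
      WAY.IsCompressedFixed M.jointMap (WAY.tensorOne HS HA) P (P * F * P) :=
    WAY.compressedFixed_of_fixed hΘ hP hfix (by rw [hM.dualLin_tensorOne, hF])
  have hfirst (hI : I.IsFirstKind E) :
      (∀ x y, Commute (E.compress P x) (E.compress P y)) ∧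
        ∀ x, Commute (E.compress P x) (P * NS * P) := by
    refine ⟨fun x y => ?_, fun x => ?_⟩
    · rw [hEc y]
      exact hcomm (hfixed (hI x)) _
    · have hEsa := (E.isPositive x).isSelfAdjoint
      have hconj {A : HS →L[ℂ] HS} (hA : IsSelfAdjoint A) : IsSelfAdjoint (P * A * P) := by
        simpa only [hPsa.star_eq] using hA.conjugate P
      refine (hfixed (hI x)).commute_of_commute_increment hΘ hP hfix (hconj hEsa) (hconj hNS)
        ?_ ?_ (fun B => WAY.commute_tensorOne B _) (hEc x) (hdelta ▸ hcommDelta (hfixed (hI x)))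
      · rw [← mul_assoc, ← mul_assoc, hidem]
      · rw [mul_assoc, hidem]
  refine ⟨ρ₀, P, ?_, hP.isMinSupportProjection, hmin, fun F hF => ?_, hfirst, fun hR => ?_⟩
  · refine hlim.congr fun N => ?_
    simp only [WAY.cesaro, WAY.onOperators_pow_coe]
  · refine ⟨fun x y => ?_, fun y => hcommDelta (hfixed (hF y)), fun _ y => hcommDelta (hfixed (hF y))⟩
    rw [hEc x]
    exact hcomm (hfixed (hF y)) _
  · have hI := hR.isFirstKind hE
    refine ⟨fun x y => ?_, (hfirst hI).2⟩
    -- The fixed point `P E(x) P` is moved inside `Ψ`, next to `1 ⊗ Z(y)`; the extra copies of `P ⊗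
    -- 1` are then absorbed by the compression.
    have h1 : E.compress P x * E.compress P y = P * WAY.dualLin M.jointMap
        (TensorProduct.mapL (E.effect x) (M.pointer.effect y)) * P := by
      rw [hEc y, WAY.Observable.compress, (hfixed (hI x)).mul_compress hΘ hP hfix,
        ← WAY.compress_dualLin hΘ hP hfix (TensorProduct.mapL (E.effect x) _),
        WAY.mapL_eq_tensorOne_mul (E.effect x),
        map_mul (WAY.tensorOne HS HA), map_mul (WAY.tensorOne HS HA)]
      simp only [mul_assoc, (WAY.commute_tensorOne P (M.pointer.effect y)).eq]
    rw [h1, hM.dualLin_mapL_effect, hR.dual_effect hE]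
    by_cases hxy : x = y
    · subst hxy
      simp [WAY.Observable.compress]
    · simp [hxy, Ne.symm hxy]
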